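/- Let $\mathbb S=\{z\in\mathbb C:0<\operatorname{Re}z<1\}$, with closure $\overline{\mathbb S}$, and let $\ell_\infty,\ell_1$ be the complex Banach spaces of bounded, respectively absolutely summable, sequences. Let $\mathscr C(\ell_\infty,\ell_1)$ be the Banach space of all bounded continuous functions $f:\overline{\mathbb S}\to\ell_\infty$ that are analytic on $\mathbb S$ and for which $t\mapsto f(it)$ is bounded and continuous from $\mathbb R$ to $\ell_\infty$ and $t\mapsto f(1+it)$ takes values in $\ell_1$ and is bounded and continuous from $\mathbb R$ to $\ell_1$, with the norm $$\|f\|=\sup\{\|f(it)\|_\infty,\ \|f(1+it)\|_1 : t\in\mathbb R\}.$$ For $z\in\mathbb S$ and $n\ge 1$ let $\mathscr C(\ell_\infty,\ell_1)^{(n)}_z$ be the Rochberg space $$\Big\{(w_{n-1},\dots,w_0)\in(\ell_\infty)^n:\ \text{there is } f\in\mathscr C(\ell_\infty,\ell_1)\text{ with } w_i=\tfrac{f^{(i)}(z)}{i!}\text{ for all }0\le i<n\Big\},$$ with the quotient norm, i.e. $\|w\|$ is the infimum of $\|f\|$ over all such $f$. Put $\mathscr Z_n=\mathscr C(\ell_\infty,\ell_1)^{(n)}_{1/2}$.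 Then for every $z\in\mathbb S$ and every $n\ge1$ the dual Banach space of $\mathscr C(\ell_\infty,\ell_1)^{(n)}_z$ is isomorphic (linearly homeomorphic) to $\mathscr C(\ell_\infty,\ell_1)^{(n)}_{1-z}$. In particular, for every $n\ge1$ the space $\mathscr Z_n$ is isomorphic to its dual. -/

import Mathlib

open scoped ENNReal BoundedContinuousFunction

noncomputable section

namespace Rochberg

/-- The open unit strip `𝕊 = {z : 0 < Re z < 1}`. -/
def strip : Set ℂ := Complex.re ⁻¹' Set.Ioo 0 1

/-- The closed unit strip `{z : 0 ≤ Re z ≤ 1}`. -/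
def closedStrip : Set ℂ := Complex.re ⁻¹' Set.Icc 0 1

/-- The point `1 - z` of the strip, for `z` in the strip. -/
def reflect (z : strip) : strip :=
  ⟨1 - z.1, by
    have h : 0 < z.1.re ∧ z.1.re < 1 := z.2
    change 0 < (1 - z.1).re ∧ (1 - z.1).re < 1
    simp only [Complex.sub_re, Complex.one_re]
    constructor <;> linarith [h.1, h.2]⟩

/-- The midpoint `1/2` of the strip. -/
def half : strip :=
  ⟨1 / 2, by
    change 0 < ((1 / 2 : ℂ)).re ∧ ((1 / 2 : ℂ)).re < 1
    norm_num⟩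

/-- A Banach couple `(X₀, X₁)`: two complex Banach spaces linearly and continuously embedded
into a third Banach space `S`. -/
structure BanachCouple (X₀ X₁ S : Type*)
    [NormedAddCommGroup X₀] [NormedSpace ℂ X₀] [CompleteSpace X₀]
    [NormedAddCommGroup X₁] [NormedSpace ℂ X₁] [CompleteSpace X₁]
    [NormedAddCommGroup S] [NormedSpace ℂ S] [CompleteSpace S] where
  /-- the embedding of `X₀` into `S` -/
  emb₀ : X₀ →L[ℂ] S
  /-- the embedding of `X₁` into `S` -/
  emb₁ : X₁ →L[ℂ] S
  injective₀ : Function.Injective emb₀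
  injective₁ : Function.Injective emb₁

section Calderon

variable {X₀ X₁ S : Type*}
  [NormedAddCommGroup X₀] [NormedSpace ℂ X₀] [CompleteSpace X₀]
  [NormedAddCommGroup X₁] [NormedSpace ℂ X₁] [CompleteSpace X₁]
  [NormedAddCommGroup S] [NormedSpace ℂ S] [CompleteSpace S]

/-- The functions of the Calderón space `𝒞(X₀, X₁)`: bounded continuous functions
`closedStrip → S`, analytic on the open strip, whose restrictions `t ↦ f (j + it)`, `j = 0, 1`,
are bounded and continuous as functions from `ℝ` to `X_j`.
A function on the closed strip is represented by its extension by zero to `ℂ`. -/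
def calderonSubmodule (K : BanachCouple X₀ X₁ S) : Submodule ℂ (ℂ → S) where
  carrier := {f |
    DifferentiableOn ℂ f strip ∧
    ContinuousOn f closedStrip ∧
    (∃ C : ℝ, ∀ w ∈ closedStrip, ‖f w‖ ≤ C) ∧
    (∀ w, w ∉ closedStrip → f w = 0) ∧
    (∃ g : ℝ →ᵇ X₀, ∀ t : ℝ, K.emb₀ (g t) = f (t * Complex.I)) ∧
    (∃ g : ℝ →ᵇ X₁, ∀ t : ℝ, K.emb₁ (g t) = f (1 + t * Complex.I))}
  add_mem' := by
    rintro f g ⟨hf, hfc, ⟨C, hC⟩, hf0, ⟨a, ha⟩, b, hb⟩ ⟨hg, hgc, ⟨D, hD⟩, hg0, ⟨a', ha'⟩, b', hb'⟩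
    refine ⟨hf.add hg, hfc.add hgc, ⟨C + D, fun w hw => ?_⟩, fun w hw => ?_,
      ⟨a + a', fun t => ?_⟩, ⟨b + b', fun t => ?_⟩⟩
    · exact (norm_add_le _ _).trans (add_le_add (hC w hw) (hD w hw))
    · simp [hf0 w hw, hg0 w hw]
    · simp [ha, ha']
    · simp [hb, hb']
  zero_mem' :=
    ⟨differentiableOn_const 0, continuousOn_const, ⟨0, fun w _ => by simp⟩, fun w _ => rfl,
      ⟨0, fun t => by simp⟩, ⟨0, fun t => by simp⟩⟩
  smul_mem' := by
    rintro c f ⟨hf, hfc, ⟨C, hC⟩, hf0, ⟨a, ha⟩, b, hb⟩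
    refine ⟨hf.const_smul c, hfc.const_smul c, ⟨‖c‖ * C, fun w hw => ?_⟩, fun w hw => ?_,
      ⟨c • a, fun t => ?_⟩, ⟨c • b, fun t => ?_⟩⟩
    · rw [Pi.smul_apply, norm_smul]
      exact mul_le_mul_of_nonneg_left (hC w hw) (norm_nonneg c)
    · simp [hf0 w hw]
    · simp [ha]
    · simp [hb]

/-- The Calderón space `𝒞(X₀, X₁)` on the unit strip. -/
def Calderon (K : BanachCouple X₀ X₁ S) : Type _ := ↥(calderonSubmodule K)

namespace Calderon

variable {K : BanachCouple X₀ X₁ S}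

instance : AddCommGroup (Calderon K) := inferInstanceAs (AddCommGroup ↥(calderonSubmodule K))
instance : Module ℂ (Calderon K) := inferInstanceAs (Module ℂ ↥(calderonSubmodule K))

/-- The underlying function. -/
def toFun (f : Calderon K) : ℂ → S := f.1

theorem toFun_add (f g : Calderon K) : (f + g).toFun = f.toFun + g.toFun := rfl

theorem toFun_smul (c : ℂ) (f : Calderon K) : (c • f).toFun = c • f.toFun := rfl

/-- The restriction `t ↦ f (it)`, a bounded continuous function with values in `X₀`. -/
def left (f : Calderon K) : ℝ →ᵇ X₀ := f.2.2.2.2.2.1.choose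

theorem emb_left (f : Calderon K) (t : ℝ) : K.emb₀ (f.left t) = f.toFun (t * Complex.I) :=
  f.2.2.2.2.2.1.choose_spec t

/-- The restriction `t ↦ f (1 + it)`, a bounded continuous function with values in `X₁`. -/
def right (f : Calderon K) : ℝ →ᵇ X₁ := f.2.2.2.2.2.2.choose

theorem emb_right (f : Calderon K) (t : ℝ) : K.emb₁ (f.right t) = f.toFun (1 + t * Complex.I) :=
  f.2.2.2.2.2.2.choose_spec t

/-- The pair of boundary restrictions. -/
def trace : Calderon K →ₗ[ℂ] (ℝ →ᵇ X₀) × (ℝ →ᵇ X₁) where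
  toFun f := (f.left, f.right)
  map_add' f g := by
    refine Prod.ext ?_ ?_
    · ext t
      apply K.injective₀
      simp [emb_left, toFun_add]
    · ext t
      apply K.injective₁
      simp [emb_right, toFun_add]
  map_smul' c f := by
    refine Prod.ext ?_ ?_
    · ext t
      apply K.injective₀
      simp [emb_left, toFun_smul]
    · ext t
      apply K.injective₁
      simp [emb_right, toFun_smul]

theorem norm_toFun_le_trace (f : Calderon K) (w : ℂ) :
    ‖f.toFun w‖ ≤ max ‖K.emb₀‖ ‖K.emb₁‖ * ‖trace f‖ := by
  have hM : 0 ≤ max ‖K.emb₀‖ ‖K.emb₁‖ * ‖trace f‖ :=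
    mul_nonneg (le_max_of_le_left (norm_nonneg _)) (norm_nonneg _)
  obtain ⟨hd, hc, ⟨C, hC⟩, h0, -, -⟩ := f.2
  by_cases hw : w ∈ closedStrip
  · have hcl : closure strip ⊆ closedStrip :=
      closure_minimal (fun z hz => ⟨hz.1.le, hz.2.le⟩)
        (isClosed_Icc.preimage Complex.continuous_re)
    have hdc : DiffContOnCl ℂ f.toFun (Complex.re ⁻¹' Set.Ioo 0 1) := ⟨hd, hc.mono hcl⟩
    refine PhragmenLindelof.vertical_strip hdc ?_ ?_ ?_ hw.1 hw.2
    · refine ⟨0, by simpa using Real.pi_pos, 0, ?_⟩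
      refine Asymptotics.IsBigO.of_bound C ?_
      filter_upwards [Filter.mem_inf_of_right (Filter.mem_principal_self _)] with z hz
      have hz' : z ∈ Complex.re ⁻¹' Set.Ioo (0 : ℝ) 1 := hz
      have hb : ‖f.toFun z‖ ≤ C := hC z ⟨hz'.1.le, hz'.2.le⟩
      simpa using hb
    · intro z hz
      have hz' : z = (z.im : ℂ) * Complex.I := by
        apply Complex.ext <;> simp [hz]
      rw [hz', ← emb_left]
      refine (K.emb₀.le_opNorm _).trans ?_
      exact mul_le_mul (le_max_left _ _)
        ((BoundedContinuousFunction.norm_coe_le_norm _ _).trans (norm_fst_le (trace f)))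
        (norm_nonneg _) (le_max_of_le_left (norm_nonneg _))
    · intro z hz
      have hz' : z = 1 + (z.im : ℂ) * Complex.I := by
        apply Complex.ext <;> simp [hz]
      rw [hz', ← emb_right]
      refine (K.emb₁.le_opNorm _).trans ?_
      exact mul_le_mul (le_max_right _ _)
        ((BoundedContinuousFunction.norm_coe_le_norm _ _).trans (norm_snd_le (trace f)))
        (norm_nonneg _) (le_max_of_le_left (norm_nonneg _))
  · have h : f.toFun w = 0 := h0 w hw
    rw [h, norm_zero]
    exact hM

theorem trace_injective : Function.Injective (trace (K := K)) := by
  rw [injective_iff_map_eq_zero]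
  intro f hf
  refine Subtype.ext (funext fun w => ?_)
  have := norm_toFun_le_trace f w
  rw [hf, norm_zero, mul_zero] at this
  exact norm_le_zero_iff.1 this

/-- The norm of the Calderón space,
`‖f‖ = sup {‖f (j + it)‖_{X_j} : t ∈ ℝ, j = 0, 1}`, as the maximum of the two sup norms. -/
instance : NormedAddCommGroup (Calderon K) :=
  NormedAddCommGroup.induced (Calderon K) ((ℝ →ᵇ X₀) × (ℝ →ᵇ X₁)) trace trace_injective

instance : NormedSpace ℂ (Calderon K) :=
  NormedSpace.induced ℂ (Calderon K) ((ℝ →ᵇ X₀) × (ℝ →ᵇ X₁)) trace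

theorem norm_def (f : Calderon K) : ‖f‖ = max ‖f.left‖ ‖f.right‖ := rfl

theorem analyticAt (f : Calderon K) (z : strip) : AnalyticAt ℂ f.toFun z.1 :=
  f.2.1.analyticAt ((isOpen_Ioo.preimage Complex.continuous_re).mem_nhds z.2)

/-- The list of Taylor coefficients `f ↦ (f^(i)(z) / i!)`, `0 ≤ i < n`. -/
def jet (K : BanachCouple X₀ X₁ S) (n : ℕ) (z : strip) : Calderon K →ₗ[ℂ] (Fin n → S) where
  toFun f i := ((i.1.factorial : ℂ))⁻¹ • iteratedDeriv i.1 f.toFun z.1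
  map_add' f g := by
    funext i
    simp only [toFun_add, Pi.add_apply]
    rw [iteratedDeriv_add (f.analyticAt z).contDiffAt (g.analyticAt z).contDiffAt, smul_add]
  map_smul' c f := by
    funext i
    simp only [toFun_smul, Pi.smul_apply, RingHom.id_apply]
    rw [iteratedDeriv_const_smul_field, smul_comm]

theorem jet_continuous (n : ℕ) (z : strip) : Continuous (jet K n z) := by
  obtain ⟨r, hr, hrs⟩ := Metric.nhds_basis_closedBall.mem_iff.1
    ((isOpen_Ioo.preimage Complex.continuous_re).mem_nhds z.2)
  refine continuous_pi fun i => ?_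
  refine AddMonoidHomClass.continuous_of_bound ((LinearMap.proj i).comp (jet K n z))
    (‖((i.1.factorial : ℂ))⁻¹‖ * (i.1.factorial * max ‖K.emb₀‖ ‖K.emb₁‖ / r ^ i.1)) fun f => ?_
  change ‖((i.1.factorial : ℂ))⁻¹ • iteratedDeriv i.1 f.toFun z.1‖ ≤ _
  rw [norm_smul, mul_assoc]
  refine mul_le_mul_of_nonneg_left ?_ (norm_nonneg _)
  have hd : DifferentiableOn ℂ f.toFun strip := f.2.1
  have := Complex.norm_iteratedDeriv_le_of_forall_mem_sphere_norm_le (F := S) i.1 hr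
    (f := f.toFun) (c := z.1) (C := max ‖K.emb₀‖ ‖K.emb₁‖ * ‖f‖)
    ((hd.mono (Metric.closure_ball_subset_closedBall.trans hrs)).diffContOnCl)
    (fun w _ => norm_toFun_le_trace f w)
  refine this.trans (le_of_eq ?_)
  ring

end Calderon

/-- The Rochberg space `𝒞(X₀, X₁)_z^(n)`: the space of all `w ∈ Sⁿ` with
`w_i = f^(i)(z) / i!` for some `f ∈ 𝒞(X₀, X₁)` and all `0 ≤ i < n`. -/
def RochbergSpace (K : BanachCouple X₀ X₁ S) (n : ℕ) (z : strip) : Type _ :=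
  ↥(LinearMap.range (Calderon.jet K n z))

namespace RochbergSpace

variable {K : BanachCouple X₀ X₁ S} {n : ℕ} {z : strip}

instance : AddCommGroup (RochbergSpace K n z) :=
  inferInstanceAs (AddCommGroup ↥(LinearMap.range (Calderon.jet K n z)))
instance : Module ℂ (RochbergSpace K n z) :=
  inferInstanceAs (Module ℂ ↥(LinearMap.range (Calderon.jet K n z)))

instance isClosed_ker : IsClosed ((LinearMap.ker (Calderon.jet K n z) : Submodule ℂ (Calderon K)) :
    Set (Calderon K)) :=
  isClosed_singleton.preimage (Calderon.jet_continuous n z)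

/-- The linear identification with the quotient of `𝒞(X₀, X₁)` by the functions whose first `n`
Taylor coefficients at `z` vanish. -/
def toQuotient (K : BanachCouple X₀ X₁ S) (n : ℕ) (z : strip) :
    RochbergSpace K n z ≃ₗ[ℂ] Calderon K ⧸ LinearMap.ker (Calderon.jet K n z) :=
  (LinearMap.quotKerEquivRange (Calderon.jet K n z)).symm

/-- The quotient norm: `‖w‖` is the infimum of `‖f‖` over the `f ∈ 𝒞(X₀, X₁)` with
`w_i = f^(i)(z) / i!` for `0 ≤ i < n`. -/
instance : NormedAddCommGroup (RochbergSpace K n z) :=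
  NormedAddCommGroup.induced (RochbergSpace K n z)
    (Calderon K ⧸ LinearMap.ker (Calderon.jet K n z)) (toQuotient K n z)
    (toQuotient K n z).injective

instance : NormedSpace ℂ (RochbergSpace K n z) :=
  NormedSpace.induced ℂ (RochbergSpace K n z)
    (Calderon K ⧸ LinearMap.ker (Calderon.jet K n z)) (toQuotient K n z)

theorem norm_eq_sInf (w : RochbergSpace K n z) :
    ‖w‖ = sInf ((fun f : Calderon K => ‖f‖) '' {f | Calderon.jet K n z f = w.1}) := by
  obtain ⟨f, hf⟩ := w.2
  have h1 : toQuotient K n z w = Submodule.Quotient.mk f := by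
    rw [← LinearEquiv.eq_symm_apply]
    exact Subtype.ext hf.symm
  change ‖toQuotient K n z w‖ = _
  rw [h1]
  refine (quotient_norm_mk_eq
    (LinearMap.ker (Calderon.jet K n z)).toAddSubgroup f).trans ?_
  congr 1
  ext r
  constructor
  · rintro ⟨g, hg, rfl⟩
    have hg' : Calderon.jet K n z g = 0 := hg
    exact ⟨f + g, by simp [hf, hg'], rfl⟩
  · rintro ⟨g, hg, rfl⟩
    have hg' : Calderon.jet K n z g = w.1 := hg
    refine ⟨g - f, ?_, by simp⟩
    change Calderon.jet K n z (g - f) = 0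
    rw [map_sub, hf, hg', sub_self]

end RochbergSpace

end Calderon

/-- The Banach couple `(ℓ_∞, ℓ_1)` of complex sequence spaces, embedded into `ℓ_∞`. -/
def ellCouple :
    BanachCouple (lp (fun _ : ℕ => ℂ) ∞) (lp (fun _ : ℕ => ℂ) 1) (lp (fun _ : ℕ => ℂ) ∞) where
  emb₀ := ContinuousLinearMap.id ℂ _
  emb₁ := (lp.linearMapOfLE ℂ (fun _ : ℕ => ℂ) (p := 1) (q := ∞) le_top).mkContinuous 1 fun f =>
    lp.norm_le_of_forall_le (by positivity) fun i => by
      simpa using lp.norm_apply_le_norm one_ne_zero f i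
  injective₀ := Function.injective_id
  injective₁ := fun f g h => by
    refine lp.ext ?_
    simpa using congrArg (fun x : lp (fun _ : ℕ => ℂ) ∞ => (x : ∀ _ : ℕ, ℂ)) h

/-- The space `𝒵_n`, the Rochberg space of order `n` of the couple `(ℓ_∞, ℓ_1)` at `1/2`. -/
abbrev ZSpace (n : ℕ) : Type := RochbergSpace ellCouple n half

end Rochberg

end

noncomputable section

namespace Rochberg

/-! ### Duality of Banach quotients through a bilinear pairing -/

section Duality

variable {C D X Y : Type*}
  [NormedAddCommGroup C] [NormedSpace ℂ C] [CompleteSpace C]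
  [NormedAddCommGroup D] [NormedSpace ℂ D] [CompleteSpace D]
  [NormedAddCommGroup X] [NormedSpace ℂ X] [CompleteSpace X]
  [NormedAddCommGroup Y] [NormedSpace ℂ Y] [CompleteSpace Y]

/-! Let φ(w) = (w - z)/(w + 1) and ψ(w) = (w - (1 - z))/(w - 2), so that ψ(1 - w) = φ(w), and put n
= m + 1. Both are bounded multipliers with a single, simple zero, so the functions with vanishing
n-jet at z are exactly φⁿ𝒞, and those with vanishing n-jet at 1 - z are ψⁿ𝒞 (`jet_eq_zero_iff`).

The duality is induced by B_m(g, f) = Σ_k c_m(f_k(w) g_k(1 - w)), where c_m is a Cauchy integral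
around z with c_0(F) = F(z) and c_{m+1}(φF) = c_m(F). The map w ↦ 1 - w exchanges the two edges of
the strip, so on each edge an ℓ_∞ value meets an ℓ_1 value; the three lines theorem carries this
bound inside (`norm_sum_coord_mul_le`) and makes B_m continuous. B_m vanishes when f ∈ φⁿ𝒞 or g ∈
ψⁿ𝒞. Testing on φᵐ times unit vectors and dividing by ψ repeatedly shows that its kernel in g is
exactly ψⁿ𝒞 (`pairing_eq_zero_iff`).

It remains to represent every functional Φ that kills φⁿ𝒞 (`exists_pairing_eq`). Induction on m
peels off the leading part Φ ∘ φᵐ, which depends only on f(z), so everything reduces to m = 0.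
There, with θ = Re z, the functions σ_k x_k^w in coordinate k show that the numbers Φ(e_k) lie in
ℓ_{1/(1-θ)} and that ℓ_{1/(1-θ)} sequences are values at 1 - z. The same test gives f(z) ∈ ℓ_{1/θ},
and f may then be replaced by a norm-convergent series of one-coordinate functions, on which Φ and
the pairing agree termwise.

Completeness turns this algebra into an isomorphism, by the open mapping and closed graph theorems.
-/

/-- Two continuous linear surjections with the same kernel have isomorphic targets. -/
theorem nonempty_equiv_of_ker_eq (φ : D →L[ℂ] X) (hφ : Function.Surjective φ)
    (ρ : D →L[ℂ] Y) (hρ : Function.Surjective ρ) (h : ∀ g, φ g = 0 ↔ ρ g = 0) :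
    Nonempty (X ≃L[ℂ] Y) := by
  have hk : LinearMap.ker φ.toLinearMap = LinearMap.ker ρ.toLinearMap := by
    ext g
    exact h g
  let e : X ≃ₗ[ℂ] Y := (φ.toLinearMap.quotKerEquivOfSurjective hφ).symm ≪≫ₗ
    Submodule.quotEquivOfEq _ _ hk ≪≫ₗ ρ.toLinearMap.quotKerEquivOfSurjective hρ
  have he : ∀ g, e (φ g) = ρ g := by
    intro g
    have h1 : (φ.toLinearMap.quotKerEquivOfSurjective hφ).symm (φ g)
        = Submodule.Quotient.mk g := by
      rw [LinearEquiv.symm_apply_eq]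
      rfl
    simp only [e, LinearEquiv.trans_apply, h1]
    rfl
  -- By the open mapping theorem `φ` is a quotient map, so continuity of `e` can be tested after
  -- composing with `φ`; the inverse is then automatically continuous.
  refine ⟨e.toContinuousLinearEquivOfContinuous ?_⟩
  rw [(φ.isQuotientMap hφ).continuous_iff]
  exact ρ.continuous.congr fun g => (he g).symm

/-- If a continuous functional vanishes on the kernel of a continuous linear surjection of Banach
spaces, it factors through that surjection. -/
theorem exists_functional_comp_eq (π : C →L[ℂ] X) (hπ : Function.Surjective π)
    (Φ : StrongDual ℂ C) (h : ∀ f, π f = 0 → Φ f = 0) :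
    ∃ φ : StrongDual ℂ X, φ.comp π = Φ := by
  let e := π.toLinearMap.quotKerEquivOfSurjective hπ
  let l : X →ₗ[ℂ] ℂ := ((LinearMap.ker π.toLinearMap).liftQ Φ.toLinearMap fun f hf => h f hf) ∘ₗ
    e.symm.toLinearMap
  have hl : ∀ f, l (π f) = Φ f := by
    intro f
    have h1 : e.symm (π f) = Submodule.Quotient.mk f := by
      rw [LinearEquiv.symm_apply_eq]
      rfl
    simp only [l, LinearMap.comp_apply, LinearEquiv.coe_coe, h1]
    rfl
  refine ⟨⟨l, ?_⟩, ?_⟩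
  · change Continuous l
    rw [(π.isQuotientMap hπ).continuous_iff]
    exact Φ.continuous.congr fun f => (hl f).symm
  · ext f
    exact hl f

/-- A continuous bilinear pairing of two Banach spaces which descends to quotients `X`, `Y`, is
nondegenerate on `Y` and represents all functionals on `X` identifies the dual of `X` with `Y`. -/
theorem nonempty_dual_equiv_of_pairing (π : C →L[ℂ] X) (hπ : Function.Surjective π)
    (ρ : D →L[ℂ] Y) (hρ : Function.Surjective ρ) (β : D →L[ℂ] C →L[ℂ] ℂ)
    (h₁ : ∀ g f, π f = 0 → β g f = 0) (h₂ : ∀ g, (∀ f, β g f = 0) ↔ ρ g = 0)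
    (h₃ : ∀ Φ : StrongDual ℂ C, (∀ f, π f = 0 → Φ f = 0) → ∃ g, β g = Φ) :
    Nonempty (StrongDual ℂ X ≃L[ℂ] Y) := by
  let P : StrongDual ℂ X →L[ℂ] StrongDual ℂ C := (ContinuousLinearMap.compL ℂ C X ℂ).flip π
  have hPa : ∀ φ f, P φ f = φ (π f) := fun _ _ => rfl
  have hP : Function.Injective P := by
    intro φ ψ h
    ext x
    obtain ⟨f, rfl⟩ := hπ x
    rw [← hPa, ← hPa, h]
  have hmem : ∀ g, β g ∈ LinearMap.range P.toLinearMap := by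
    intro g
    obtain ⟨φ, hφ⟩ := exists_functional_comp_eq π hπ (β g) (h₁ g)
    exact ⟨φ, hφ⟩
  let e := LinearEquiv.ofInjective P.toLinearMap hP
  let l : D →ₗ[ℂ] StrongDual ℂ X :=
    e.symm.toLinearMap ∘ₗ β.toLinearMap.codRestrict (LinearMap.range P.toLinearMap) hmem
  have hl : ∀ g, P (l g) = β g := by
    intro g
    have : e (l g) = ⟨β g, hmem g⟩ := by
      change e (e.symm _) = _
      rw [LinearEquiv.apply_symm_apply]
      rfl
    exact congrArg Subtype.val this
  -- Closed graph: `P` is continuous and injective and `P ∘ l = β` is continuous, so limits along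
  -- the graph are determined after applying `P`.
  have hc : Continuous l := by
    refine l.continuous_of_seq_closed_graph fun u x y hu hy => ?_
    apply hP
    rw [hl]
    refine tendsto_nhds_unique ?_ ((β.continuous.tendsto x).comp hu)
    refine ((P.continuous.tendsto y).comp hy).congr fun n => ?_
    exact hl (u n)
  let φ : D →L[ℂ] StrongDual ℂ X := ⟨l, hc⟩
  have hφa : ∀ g, P (φ g) = β g := hl
  refine nonempty_equiv_of_ker_eq φ (fun ψ => ?_) ρ hρ fun g => ?_
  · obtain ⟨g, hg⟩ := h₃ (P ψ) fun f hf => by rw [hPa, hf, map_zero]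
    exact ⟨g, hP (by rw [hφa, hg])⟩
  · rw [← h₂, ← map_eq_zero_iff P hP, hφa]
    exact DFunLike.ext_iff

end Duality

/-! ### Completeness of Calderón and Rochberg spaces -/

section Complete

variable {X₀ X₁ S : Type*}
  [NormedAddCommGroup X₀] [NormedSpace ℂ X₀] [CompleteSpace X₀]
  [NormedAddCommGroup X₁] [NormedSpace ℂ X₁] [CompleteSpace X₁]
  [NormedAddCommGroup S] [NormedSpace ℂ S] [CompleteSpace S]
  {K : BanachCouple X₀ X₁ S}

theorem isOpen_strip : IsOpen strip := isOpen_Ioo.preimage Complex.continuous_re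

theorem strip_subset_closedStrip : strip ⊆ closedStrip := fun _ hz => ⟨hz.1.le, hz.2.le⟩

theorem closure_strip_subset : closure strip ⊆ closedStrip :=
  closure_minimal strip_subset_closedStrip (isClosed_Icc.preimage Complex.continuous_re)

namespace Calderon

/-- By the three lines bound the boundary norm controls the sup norm on the whole strip, so a Cauchy
sequence converges uniformly, preserving analyticity and continuity, while its traces converge in
the complete spaces of edge functions. -/
instance : CompleteSpace (Calderon K) := by
  refine Metric.complete_of_cauchySeq_tendsto fun u hu => ?_
  have hiso : Isometry (trace (K := K)) := AddMonoidHomClass.isometry_of_norm _ fun f => rfl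
  obtain ⟨p, hp⟩ := cauchySeq_tendsto_of_complete (hiso.uniformContinuous.comp_cauchySeq hu)
  have hM : 0 ≤ max ‖K.emb₀‖ ‖K.emb₁‖ := le_max_of_le_left (norm_nonneg _)
  have hdist : ∀ f g : Calderon K, ∀ w, dist (f.toFun w) (g.toFun w) ≤
      max ‖K.emb₀‖ ‖K.emb₁‖ * dist f g := by
    intro f g w
    have := norm_toFun_le_trace (f - g) w
    rw [dist_eq_norm, dist_eq_norm]
    exact this
  have hcau : ∀ ε > 0, ∃ N, ∀ m ≥ N, ∀ n ≥ N, ∀ w, dist ((u m).toFun w) ((u n).toFun w) < ε := by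
    intro ε hε
    obtain ⟨N, hN⟩ := Metric.cauchySeq_iff.1 hu (ε / (max ‖K.emb₀‖ ‖K.emb₁‖ + 1)) (by positivity)
    refine ⟨N, fun m hm n hn w => (hdist _ _ w).trans_lt ?_⟩
    have := hN m hm n hn
    rw [lt_div_iff₀ (by positivity)] at this
    nlinarith [dist_nonneg (x := u m) (y := u n)]
  have hlim : ∀ w, ∃ y, Filter.Tendsto (fun n => (u n).toFun w) Filter.atTop (nhds y) := by
    intro w
    refine cauchySeq_tendsto_of_complete (Metric.cauchySeq_iff.2 fun ε hε => ?_)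
    obtain ⟨N, hN⟩ := hcau ε hε
    exact ⟨N, fun m hm n hn => hN m hm n hn w⟩
  choose F hF using hlim
  have hunif : TendstoUniformly (fun n => (u n).toFun) F Filter.atTop := by
    rw [← tendstoUniformlyOn_univ]
    refine UniformCauchySeqOn.tendstoUniformlyOn_of_tendsto ?_ fun w _ => hF w
    rw [Metric.uniformCauchySeqOn_iff]
    intro ε hε
    obtain ⟨N, hN⟩ := hcau ε hε
    exact ⟨N, fun m hm n hn w _ => hN m hm n hn w⟩
  have hb : ∃ B, ∀ n, ‖u n‖ ≤ B := by
    obtain ⟨B, hB⟩ := hu.isBounded_range.exists_norm_le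
    exact ⟨B, fun n => hB _ ⟨n, rfl⟩⟩
  obtain ⟨B, hB⟩ := hb
  have hl : ∀ t : ℝ, K.emb₀ (p.1 t) = F (t * Complex.I) := by
    intro t
    have h1 : Filter.Tendsto (fun n => (u n).left) Filter.atTop (nhds p.1) :=
      (continuous_fst.tendsto p).comp hp
    have h2 : Filter.Tendsto (fun n => K.emb₀ ((u n).left t)) Filter.atTop
        (nhds (K.emb₀ (p.1 t))) :=
      (K.emb₀.continuous.tendsto _).comp
        (((continuous_eval_const t).tendsto _).comp h1)
    refine tendsto_nhds_unique h2 ((hF _).congr fun n => ?_)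
    rw [emb_left]
  have hr : ∀ t : ℝ, K.emb₁ (p.2 t) = F (1 + t * Complex.I) := by
    intro t
    have h1 : Filter.Tendsto (fun n => (u n).right) Filter.atTop (nhds p.2) :=
      (continuous_snd.tendsto p).comp hp
    have h2 : Filter.Tendsto (fun n => K.emb₁ ((u n).right t)) Filter.atTop
        (nhds (K.emb₁ (p.2 t))) :=
      (K.emb₁.continuous.tendsto _).comp
        (((continuous_eval_const t).tendsto _).comp h1)
    refine tendsto_nhds_unique h2 ((hF _).congr fun n => ?_)
    rw [emb_right]
  let f : Calderon K := ⟨F, hunif.tendstoUniformlyOn.tendstoLocallyUniformlyOn.differentiableOn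
      (Filter.Eventually.of_forall fun n => (u n).2.1) isOpen_strip,
    hunif.tendstoUniformlyOn.continuousOn (Filter.Frequently.of_forall fun n => (u n).2.2.1),
    ⟨max ‖K.emb₀‖ ‖K.emb₁‖ * B, fun w _ => le_of_tendsto' (hF w).norm fun n =>
      (norm_toFun_le_trace (u n) w).trans (mul_le_mul_of_nonneg_left (hB n) hM)⟩,
    fun w hw => tendsto_nhds_unique (hF w) ((tendsto_const_nhds (x := (0 : S))).congr fun n =>
      ((u n).2.2.2.2.1 w hw).symm),
    ⟨p.1, hl⟩, ⟨p.2, hr⟩⟩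
  refine ⟨f, ?_⟩
  have hfp : trace f = p := by
    refine Prod.ext ?_ ?_
    · ext t
      apply K.injective₀
      rw [hl]
      exact emb_left f t
    · ext t
      apply K.injective₁
      rw [hr]
      exact emb_right f t
  rw [hiso.isEmbedding.isInducing.tendsto_nhds_iff, hfp]
  exact hp

end Calderon

namespace RochbergSpace

variable {n : ℕ} {z : strip}

instance : CompleteSpace (RochbergSpace K n z) := by
  have hiso : Isometry (toQuotient K n z) := AddMonoidHomClass.isometry_of_norm _ fun f => rfl
  have : IsUniformInducing (toQuotient K n z) := hiso.isUniformInducing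
  rw [completeSpace_iff_isComplete_range this, (toQuotient K n z).surjective.range_eq]
  have : CompleteSpace (Calderon K ⧸ LinearMap.ker (Calderon.jet K n z)) :=
    inferInstance
  exact isComplete_univ

/-- The map `f ↦ (f^(i)(z) / i!)` onto the Rochberg space. -/
def ofCalderon (K : BanachCouple X₀ X₁ S) (n : ℕ) (z : strip) :
    Calderon K →L[ℂ] RochbergSpace K n z :=
  LinearMap.mkContinuous
    ((LinearMap.rangeRestrict (Calderon.jet K n z) :
      Calderon K →ₗ[ℂ] ↥(LinearMap.range (Calderon.jet K n z)))) 1 fun f => by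
    rw [one_mul]
    refine (norm_eq_sInf (K := K) (n := n) (z := z)
      ((Calderon.jet K n z).rangeRestrict f)).trans_le ?_
    exact csInf_le ⟨0, by rintro _ ⟨g, -, rfl⟩; exact norm_nonneg g⟩ ⟨f, rfl, rfl⟩

theorem ofCalderon_surjective : Function.Surjective (ofCalderon K n z) := by
  rintro ⟨_, f, rfl⟩
  exact ⟨f, rfl⟩

theorem ofCalderon_eq_zero_iff (f : Calderon K) :
    ofCalderon K n z f = 0 ↔ Calderon.jet K n z f = 0 :=
  Subtype.ext_iff

end RochbergSpace

end Complete

/-! ### Scalar multipliers and division by a simple zero -/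

section Multiplier

variable {X₀ X₁ S : Type*}
  [NormedAddCommGroup X₀] [NormedSpace ℂ X₀] [CompleteSpace X₀]
  [NormedAddCommGroup X₁] [NormedSpace ℂ X₁] [CompleteSpace X₁]
  [NormedAddCommGroup S] [NormedSpace ℂ S] [CompleteSpace S]
  {K : BanachCouple X₀ X₁ S}

theorem left_mem_closedStrip (t : ℝ) : (t * Complex.I : ℂ) ∈ closedStrip := by
  simp [closedStrip]

theorem right_mem_closedStrip (t : ℝ) : (1 + t * Complex.I : ℂ) ∈ closedStrip := by
  simp [closedStrip]

theorem left_notMem_strip (t : ℝ) : (t * Complex.I : ℂ) ∉ strip := by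
  simp [strip]

theorem right_notMem_strip (t : ℝ) : (1 + t * Complex.I : ℂ) ∉ strip := by
  simp [strip]

/-- The bounded scalar functions on the closed strip which act on Calderón spaces. -/
structure IsMultiplier (m : ℂ → ℂ) : Prop where
  differentiableOn : DifferentiableOn ℂ m strip
  continuousOn : ContinuousOn m closedStrip
  bounded : ∃ C, ∀ w ∈ closedStrip, ‖m w‖ ≤ C

namespace Calderon

theorem left_apply_eq {f : Calderon K} {t : ℝ} {x : X₀}
    (h : K.emb₀ x = f.toFun (t * Complex.I)) : f.left t = x :=
  K.injective₀ (by rw [emb_left, h])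

theorem right_apply_eq {f : Calderon K} {t : ℝ} {x : X₁}
    (h : K.emb₁ x = f.toFun (1 + t * Complex.I)) : f.right t = x :=
  K.injective₁ (by rw [emb_right, h])

theorem toFun_injective : Function.Injective (toFun (K := K)) := Subtype.val_injective

theorem eq_of_eqOn {f g : Calderon K} (h : ∀ w ∈ closedStrip, f.toFun w = g.toFun w) : f = g := by
  refine toFun_injective (funext fun w => ?_)
  by_cases hw : w ∈ closedStrip
  · exact h w hw
  · exact (f.2.2.2.2.1 w hw).trans (g.2.2.2.2.1 w hw).symm

theorem norm_le {f : Calderon K} {C : ℝ} (h₀ : ∀ t, ‖f.left t‖ ≤ C) (h₁ : ∀ t, ‖f.right t‖ ≤ C) :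
    ‖f‖ ≤ C := by
  have hC : 0 ≤ C := (norm_nonneg _).trans (h₀ 0)
  rw [norm_def]
  exact max_le ((BoundedContinuousFunction.norm_le hC).2 h₀)
    ((BoundedContinuousFunction.norm_le hC).2 h₁)

theorem norm_left_le (f : Calderon K) (t : ℝ) : ‖f.left t‖ ≤ ‖f‖ :=
  (f.left.norm_coe_le_norm t).trans (norm_def f ▸ le_max_left _ _)

theorem norm_right_le (f : Calderon K) (t : ℝ) : ‖f.right t‖ ≤ ‖f‖ :=
  (f.right.norm_coe_le_norm t).trans (norm_def f ▸ le_max_right _ _)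

/-- A function on the closed strip with the regularity required in the Calderón space. -/
def ofFun (F : ℂ → S) (hd : DifferentiableOn ℂ F strip) (hc : ContinuousOn F closedStrip)
    (hb : ∃ C, ∀ w ∈ closedStrip, ‖F w‖ ≤ C)
    (h₀ : ∃ g : ℝ →ᵇ X₀, ∀ t : ℝ, K.emb₀ (g t) = F (t * Complex.I))
    (h₁ : ∃ g : ℝ →ᵇ X₁, ∀ t : ℝ, K.emb₁ (g t) = F (1 + t * Complex.I)) : Calderon K :=
  ⟨closedStrip.indicator F,
    hd.congr fun _ hw => Set.indicator_of_mem (strip_subset_closedStrip hw) F,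
    hc.congr fun _ hw => Set.indicator_of_mem hw F,
    hb.imp fun C hC w hw => by rw [Set.indicator_of_mem hw]; exact hC w hw,
    fun _ hw => Set.indicator_of_notMem hw F,
    h₀.imp fun g hg t => by rw [Set.indicator_of_mem (left_mem_closedStrip t)]; exact hg t,
    h₁.imp fun g hg t => by rw [Set.indicator_of_mem (right_mem_closedStrip t)]; exact hg t⟩

theorem ofFun_toFun {F : ℂ → S} {hd : DifferentiableOn ℂ F strip} {hc : ContinuousOn F closedStrip}
    {hb : ∃ C, ∀ w ∈ closedStrip, ‖F w‖ ≤ C}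
    {h₀ : ∃ g : ℝ →ᵇ X₀, ∀ t : ℝ, K.emb₀ (g t) = F (t * Complex.I)}
    {h₁ : ∃ g : ℝ →ᵇ X₁, ∀ t : ℝ, K.emb₁ (g t) = F (1 + t * Complex.I)} {w : ℂ}
    (hw : w ∈ closedStrip) : (ofFun F hd hc hb h₀ h₁).toFun w = F w :=
  Set.indicator_of_mem hw F

/-- The product of a bounded continuous vector function and a bounded continuous scalar function. -/
theorem exists_boundedContinuous_smul {X : Type*} [NormedAddCommGroup X] [NormedSpace ℂ X]
    {m : ℝ → ℂ} (hm : Continuous m) {C : ℝ} (hC : ∀ t, ‖m t‖ ≤ C) (g : ℝ →ᵇ X) :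
    ∃ h : ℝ →ᵇ X, ∀ t, h t = m t • g t :=
  ⟨.ofNormedAddCommGroup (fun t => m t • g t) (hm.smul g.continuous) (C * ‖g‖) fun t => by
    rw [norm_smul]
    exact mul_le_mul (hC t) (g.norm_coe_le_norm t) (norm_nonneg _) ((norm_nonneg _).trans (hC t)),
    fun _ => rfl⟩

theorem _root_.ContinuousOn.comp_left {m : ℂ → ℂ} (hm : ContinuousOn m closedStrip) :
    Continuous fun t : ℝ => m (t * Complex.I) :=
  hm.comp_continuous (by fun_prop) left_mem_closedStrip

theorem _root_.ContinuousOn.comp_right {m : ℂ → ℂ} (hm : ContinuousOn m closedStrip) :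
    Continuous fun t : ℝ => m (1 + t * Complex.I) :=
  hm.comp_continuous (by fun_prop) right_mem_closedStrip

/-- Multiplication by a scalar multiplier, as a linear map. -/
def mulₗ (K : BanachCouple X₀ X₁ S) {m : ℂ → ℂ} (hm : IsMultiplier m) :
    Calderon K →ₗ[ℂ] Calderon K where
  toFun f := ofFun (fun w => m w • f.toFun w) (hm.differentiableOn.smul f.2.1)
    (hm.continuousOn.smul f.2.2.1)
    (by
      obtain ⟨C, hC⟩ := hm.bounded
      obtain ⟨D, hD⟩ := f.2.2.2.1
      refine ⟨C * D, fun w hw => ?_⟩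
      rw [norm_smul]
      exact mul_le_mul (hC w hw) (hD w hw) (norm_nonneg _) ((norm_nonneg _).trans (hC w hw)))
    (by
      obtain ⟨C, hC⟩ := hm.bounded
      obtain ⟨h, hh⟩ := exists_boundedContinuous_smul hm.continuousOn.comp_left
        (fun t => hC _ (left_mem_closedStrip t)) f.left
      exact ⟨h, fun t => by rw [hh, map_smul, emb_left]⟩)
    (by
      obtain ⟨C, hC⟩ := hm.bounded
      obtain ⟨h, hh⟩ := exists_boundedContinuous_smul hm.continuousOn.comp_right
        (fun t => hC _ (right_mem_closedStrip t)) f.right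
      exact ⟨h, fun t => by rw [hh, map_smul, emb_right]⟩)
  map_add' f g := eq_of_eqOn fun w hw => by
    simp only [toFun_add, Pi.add_apply, ofFun_toFun hw, smul_add]
  map_smul' c f := eq_of_eqOn fun w hw => by
    simp only [toFun_smul, Pi.smul_apply, ofFun_toFun hw, RingHom.id_apply]
    rw [smul_comm]

theorem mulₗ_toFun {m : ℂ → ℂ} (hm : IsMultiplier m) (f : Calderon K) {w : ℂ}
    (hw : w ∈ closedStrip) : (mulₗ K hm f).toFun w = m w • f.toFun w :=
  Set.indicator_of_mem hw fun w => m w • f.toFun w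

theorem mulₗ_left {m : ℂ → ℂ} (hm : IsMultiplier m) (f : Calderon K) (t : ℝ) :
    (mulₗ K hm f).left t = m (t * Complex.I) • f.left t :=
  left_apply_eq (by rw [mulₗ_toFun hm f (left_mem_closedStrip t), map_smul, emb_left])

theorem mulₗ_right {m : ℂ → ℂ} (hm : IsMultiplier m) (f : Calderon K) (t : ℝ) :
    (mulₗ K hm f).right t = m (1 + t * Complex.I) • f.right t :=
  right_apply_eq (by rw [mulₗ_toFun hm f (right_mem_closedStrip t), map_smul, emb_right])

/-- Multiplication by a scalar multiplier. -/
def mul (K : BanachCouple X₀ X₁ S) {m : ℂ → ℂ} (hm : IsMultiplier m) :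
    Calderon K →L[ℂ] Calderon K :=
  (mulₗ K hm).mkContinuous hm.bounded.choose fun f => by
    have hC := hm.bounded.choose_spec
    refine norm_le (fun t => ?_) fun t => ?_
    · rw [mulₗ_left, norm_smul]
      exact mul_le_mul (hC _ (left_mem_closedStrip t)) (norm_left_le f t) (norm_nonneg _)
        ((norm_nonneg _).trans (hC _ (left_mem_closedStrip t)))
    · rw [mulₗ_right, norm_smul]
      exact mul_le_mul (hC _ (right_mem_closedStrip t)) (norm_right_le f t) (norm_nonneg _)
        ((norm_nonneg _).trans (hC _ (right_mem_closedStrip t)))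

theorem mul_toFun {m : ℂ → ℂ} (hm : IsMultiplier m) (f : Calderon K) {w : ℂ}
    (hw : w ∈ closedStrip) : (mul K hm f).toFun w = m w • f.toFun w :=
  Set.indicator_of_mem hw fun w => m w • f.toFun w

theorem mul_right {m : ℂ → ℂ} (hm : IsMultiplier m) (f : Calderon K) (t : ℝ) :
    (mul K hm f).right t = m (1 + t * Complex.I) • f.right t :=
  mulₗ_right hm f t

end Calderon

/-- The multiplier `w ↦ (w - z) / (w - a)`, with a simple zero at `z`. -/
def ratio (z a : ℂ) (w : ℂ) : ℂ := (w - z) / (w - a)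

/-- The point `a` has positive distance to the closed strip. -/
def IsFar (a : ℂ) : Prop := ∃ δ > 0, ∀ w ∈ closedStrip, δ ≤ ‖w - a‖

/-- The poles `-1` and `2` are exchanged by w ↦ 1 - w, which is what makes the ratios at z and at 1
- z correspond. -/
theorem isFar_neg_one : IsFar (-1) := by
  refine ⟨1, one_pos, fun w hw => ?_⟩
  have h : 0 ≤ w.re ∧ w.re ≤ 1 := hw
  refine le_trans ?_ (Complex.re_le_norm _)
  simp [h.1]

theorem isFar_two : IsFar 2 := by
  refine ⟨1, one_pos, fun w hw => ?_⟩
  have h : 0 ≤ w.re ∧ w.re ≤ 1 := hw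
  rw [norm_sub_rev]
  refine le_trans ?_ (Complex.re_le_norm _)
  simp only [Complex.sub_re, Complex.re_ofNat]
  linarith

theorem IsFar.sub_ne_zero {a w : ℂ} (ha : IsFar a) (hw : w ∈ closedStrip) : w - a ≠ 0 := by
  obtain ⟨δ, hδ, h⟩ := ha
  exact norm_pos_iff.1 (hδ.trans_le (h w hw))

theorem IsFar.isMultiplier_ratio {a : ℂ} (ha : IsFar a) (z : ℂ) : IsMultiplier (ratio z a) where
  differentiableOn := DifferentiableOn.div (by fun_prop) (by fun_prop) fun w hw =>
    ha.sub_ne_zero (strip_subset_closedStrip hw)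
  continuousOn := ContinuousOn.div (by fun_prop) (by fun_prop) fun w hw => ha.sub_ne_zero hw
  bounded := by
    obtain ⟨δ, hδ, h⟩ := id ha
    refine ⟨1 + ‖a - z‖ / δ, fun w hw => ?_⟩
    have : ratio z a w = 1 + (a - z) / (w - a) := by
      have := ha.sub_ne_zero hw
      unfold ratio
      field_simp
      ring
    rw [this]
    refine (norm_add_le _ _).trans ?_
    rw [norm_one, norm_div]
    gcongr
    exact h w hw

namespace Calderon

/-- A function of the Calderón space which vanishes at `z` is divisible by `(w - z) / (w - a)`. -/
theorem exists_eq_mul_ratio {a : ℂ} (ha : IsFar a) (z : strip) (f : Calderon K)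
    (hf : f.toFun z.1 = 0) : ∃ g : Calderon K, f = mul K (ha.isMultiplier_ratio z.1) g := by
  obtain ⟨r, hr, hrs⟩ := Metric.nhds_basis_closedBall.mem_iff.1 (isOpen_strip.mem_nhds z.2)
  have hz : strip ∈ nhds z.1 := isOpen_strip.mem_nhds z.2
  -- The quotient of f by the ratio is (w - a) times the difference quotient of f at z; `dslope`
  -- fills in the removable singularity.
  have hd : DifferentiableOn ℂ (fun w => (w - a) • dslope f.toFun z.1 w) strip :=
    DifferentiableOn.smul (by fun_prop) ((Complex.differentiableOn_dslope hz).2 f.2.1)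
  have hc : ContinuousOn (fun w => (w - a) • dslope f.toFun z.1 w) closedStrip :=
    ContinuousOn.smul (by fun_prop)
      ((continuousOn_dslope (Filter.mem_of_superset hz strip_subset_closedStrip)).2
        ⟨f.2.2.1, f.2.1.differentiableAt hz⟩)
  -- On the edges the quotient is a bounded scalar times f, so its values stay in `X₀` and `X₁` with
  -- the right continuity.
  have hout : ∀ w ∉ strip, (w - a) • dslope f.toFun z.1 w = ((w - a) / (w - z.1)) • f.toFun w := by
    intro w hw
    have hwz : w ≠ z.1 := fun h => hw (h ▸ z.2)
    rw [dslope_of_ne _ hwz, slope_def_module, hf, sub_zero, smul_smul, div_eq_mul_inv]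
  have hfac : ∀ w, r ≤ ‖w - z.1‖ → ‖(w - a) / (w - z.1)‖ ≤ 1 + ‖z.1 - a‖ / r := by
    intro w hw
    have h0 : w - z.1 ≠ 0 := norm_pos_iff.1 (hr.trans_le hw)
    have : (w - a) / (w - z.1) = 1 + (z.1 - a) / (w - z.1) := by
      field_simp
      ring
    rw [this]
    refine (norm_add_le _ _).trans ?_
    rw [norm_one, norm_div]
    gcongr
  have hfar : ∀ w ∉ strip, r ≤ ‖w - z.1‖ := by
    intro w hw
    by_contra! h
    exact hw (hrs (by rw [Metric.mem_closedBall, dist_eq_norm]; exact h.le))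
  have hdiv : ContinuousOn (fun w : ℂ => (w - a) / (w - z.1)) stripᶜ :=
    ContinuousOn.div (by fun_prop) (by fun_prop) fun w hw =>
      norm_pos_iff.1 (hr.trans_le (hfar w hw))
  obtain ⟨g₀, hg₀⟩ := exists_boundedContinuous_smul
    (hdiv.comp_continuous (f := fun t : ℝ => (t * Complex.I : ℂ)) (by fun_prop) left_notMem_strip)
    (fun t => hfac _ (hfar _ (left_notMem_strip t))) f.left
  obtain ⟨g₁, hg₁⟩ := exists_boundedContinuous_smul
    (hdiv.comp_continuous (f := fun t : ℝ => (1 + t * Complex.I : ℂ)) (by fun_prop)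
      right_notMem_strip)
    (fun t => hfac _ (hfar _ (right_notMem_strip t))) f.right
  -- Compactness bounds the quotient near z, where the scalar factor blows up; `hfac` bounds it
  -- elsewhere.
  have hb : ∃ C, ∀ w ∈ closedStrip, ‖(w - a) • dslope f.toFun z.1 w‖ ≤ C := by
    obtain ⟨B, hB⟩ := (isCompact_closedBall z.1 r).exists_bound_of_continuousOn
      (hc.mono (hrs.trans strip_subset_closedStrip))
    obtain ⟨D, hD⟩ := f.2.2.2.1
    refine ⟨max B ((1 + ‖z.1 - a‖ / r) * D), fun w hw => ?_⟩
    by_cases h : w ∈ Metric.closedBall z.1 r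
    · exact (hB w h).trans (le_max_left _ _)
    · rw [Metric.mem_closedBall, dist_eq_norm, not_le] at h
      have hwz : w ≠ z.1 := by
        rintro rfl
        rw [sub_self, norm_zero] at h
        exact h.not_gt hr
      refine le_trans ?_ (le_max_right _ _)
      rw [dslope_of_ne _ hwz, slope_def_module, hf, sub_zero, smul_smul, ← div_eq_mul_inv,
        norm_smul]
      exact mul_le_mul (hfac w h.le) (hD w hw) (norm_nonneg _) (by positivity)
  refine ⟨ofFun _ hd hc hb ⟨g₀, fun t => ?_⟩ ⟨g₁, fun t => ?_⟩, eq_of_eqOn fun w hw => ?_⟩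
  · rw [hg₀, map_smul, emb_left, hout _ (left_notMem_strip t)]
    rfl
  · rw [hg₁, map_smul, emb_right, hout _ (right_notMem_strip t)]
    rfl
  · rw [mul_toFun _ _ hw, ofFun_toFun hw, smul_smul, ratio, div_mul_cancel₀ _ (ha.sub_ne_zero hw),
      sub_smul_dslope, hf, sub_zero]

theorem jet_eq_zero_iff_le_order (n : ℕ) (z : strip) (f : Calderon K) :
    jet K n z f = 0 ↔ (n : ℕ∞) ≤ analyticOrderAt f.toFun z.1 := by
  rw [natCast_le_analyticOrderAt_iff_iteratedDeriv_eq_zero (f.analyticAt z)]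
  constructor
  · intro h i hi
    have h1 : ((i.factorial : ℂ))⁻¹ • iteratedDeriv i f.toFun z.1 = 0 := congrFun h ⟨i, hi⟩
    exact (smul_eq_zero.1 h1).resolve_left (inv_ne_zero (Nat.cast_ne_zero.2 i.factorial_ne_zero))
  · intro h
    funext i
    change ((i.1.factorial : ℂ))⁻¹ • iteratedDeriv i.1 f.toFun z.1 = 0
    rw [h i.1 i.2, smul_zero]

theorem order_mul_ratio {a : ℂ} (ha : IsFar a) (z : strip) (f : Calderon K) :
    analyticOrderAt (mul K (ha.isMultiplier_ratio z.1) f).toFun z.1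
      = 1 + analyticOrderAt f.toFun z.1 := by
  have hz : strip ∈ nhds z.1 := isOpen_strip.mem_nhds z.2
  have hr : AnalyticAt ℂ (ratio z.1 a) z.1 :=
    (ha.isMultiplier_ratio z.1).differentiableOn.analyticAt hz
  have hza := ha.sub_ne_zero (strip_subset_closedStrip z.2)
  have hr1 : analyticOrderAt (ratio z.1 a) z.1 = (1 : ℕ) := by
    rw [hr.analyticOrderAt_eq_natCast]
    refine ⟨fun w => (w - a)⁻¹, ?_, inv_ne_zero hza, ?_⟩
    · exact AnalyticAt.inv (by fun_prop) hza
    · exact Filter.Eventually.of_forall fun w => by simp [ratio, div_eq_mul_inv]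
  have heq : (mul K (ha.isMultiplier_ratio z.1) f).toFun =ᶠ[nhds z.1] ratio z.1 a • f.toFun := by
    filter_upwards [hz] with w hw
    exact mul_toFun _ f (strip_subset_closedStrip hw)
  rw [analyticOrderAt_congr heq, analyticOrderAt_smul hr (f.analyticAt z), hr1, Nat.cast_one]

/-- The functions whose first `n` Taylor coefficients at `z` vanish are the multiples of
`((w - z) / (w - a)) ^ n`. -/
theorem jet_eq_zero_iff {a : ℂ} (ha : IsFar a) (z : strip) (n : ℕ) (f : Calderon K) :
    jet K n z f = 0 ↔ ∃ g, f = (mul K (ha.isMultiplier_ratio z.1) ^ n) g := by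
  rw [jet_eq_zero_iff_le_order]
  induction n generalizing f with
  | zero => simp
  | succ n ih =>
    constructor
    · intro h
      -- Order at least n + 1 forces a zero, so one factor splits off and the order drops by exactly
      -- one.
      have h0 : f.toFun z.1 = 0 := by
        rw [← (f.analyticAt z).analyticOrderAt_ne_zero]
        intro h0
        rw [h0] at h
        simp at h
      obtain ⟨g, rfl⟩ := exists_eq_mul_ratio ha z f h0
      rw [order_mul_ratio ha, Nat.cast_succ, add_comm, ENat.add_le_add_iff_left (by simp), ih] at h
      obtain ⟨u, rfl⟩ := h
      exact ⟨u, by rw [pow_succ']; rfl⟩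
    · rintro ⟨g, rfl⟩
      have : (mul K (ha.isMultiplier_ratio z.1) ^ (n + 1)) g
          = mul K (ha.isMultiplier_ratio z.1) ((mul K (ha.isMultiplier_ratio z.1) ^ n) g) := by
        rw [pow_succ']; rfl
      rw [this, order_mul_ratio ha, Nat.cast_succ, add_comm]
      exact add_le_add_right ((ih _).2 ⟨g, rfl⟩) 1

theorem jet_one_eq_zero_iff (z : strip) (f : Calderon K) :
    jet K 1 z f = 0 ↔ f.toFun z.1 = 0 := by
  constructor
  · intro h
    have h1 : ((Nat.factorial 0 : ℂ))⁻¹ • iteratedDeriv 0 f.toFun z.1 = 0 := congrFun h 0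
    simpa using h1
  · intro h
    funext i
    obtain rfl : i = 0 := Subsingleton.elim _ _
    change ((Nat.factorial 0 : ℂ))⁻¹ • iteratedDeriv 0 f.toFun z.1 = 0
    simp [h]

end Calderon

end Multiplier

/-! ### Coordinates and the three lines bound for the pairing -/

namespace Calderon

/-- The `k`-th coordinate of the value at `w` of a function in `𝒞(ℓ_∞, ℓ_1)`. -/
def coord (k : ℕ) (w : ℂ) : Calderon ellCouple →L[ℂ] ℂ :=
  LinearMap.mkContinuous
    { toFun := fun f => (f.toFun w : ∀ _ : ℕ, ℂ) k
      map_add' := fun f g => by rw [toFun_add]; rfl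
      map_smul' := fun c f => by rw [toFun_smul]; rfl }
    (max ‖ellCouple.emb₀‖ ‖ellCouple.emb₁‖) fun f =>
      (lp.norm_apply_le_norm ENNReal.top_ne_zero (f.toFun w) k).trans (norm_toFun_le_trace f w)

theorem coord_apply (k : ℕ) (w : ℂ) (f : Calderon ellCouple) :
    coord k w f = (f.toFun w : ∀ _ : ℕ, ℂ) k := rfl

theorem toFun_eq_zero_iff (f : Calderon ellCouple) (w : ℂ) :
    f.toFun w = 0 ↔ ∀ k, coord k w f = 0 := by
  constructor
  · intro h k
    rw [coord_apply, h]
    rfl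
  · intro h
    exact lp.ext (funext h)

theorem coord_mul {m : ℂ → ℂ} (hm : IsMultiplier m) (f : Calderon ellCouple) (k : ℕ) {w : ℂ}
    (hw : w ∈ closedStrip) : coord k w (mul ellCouple hm f) = m w * coord k w f := by
  rw [coord_apply, mul_toFun hm f hw]
  rfl

theorem differentiableOn_coord (f : Calderon ellCouple) (k : ℕ) :
    DifferentiableOn ℂ (fun w => coord k w f) strip :=
  (lp.evalCLM ℂ (fun _ : ℕ => ℂ) ∞ k).differentiable.comp_differentiableOn f.2.1

theorem continuousOn_coord (f : Calderon ellCouple) (k : ℕ) :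
    ContinuousOn (fun w => coord k w f) closedStrip :=
  (lp.evalCLM ℂ (fun _ : ℕ => ℂ) ∞ k).continuous.comp_continuousOn f.2.2.1

theorem coord_left (f : Calderon ellCouple) (k : ℕ) (t : ℝ) :
    coord k (t * Complex.I) f = f.left t k := by
  rw [coord_apply, ← emb_left]
  rfl

theorem coord_right (f : Calderon ellCouple) (k : ℕ) (t : ℝ) :
    coord k (1 + t * Complex.I) f = f.right t k := by
  rw [coord_apply, ← emb_right]
  rfl

theorem norm_coord_left_le (f : Calderon ellCouple) (k : ℕ) (t : ℝ) :
    ‖coord k (t * Complex.I) f‖ ≤ ‖f‖ := by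
  rw [coord_left]
  exact (lp.norm_apply_le_norm ENNReal.top_ne_zero _ k).trans (norm_left_le f t)

theorem sum_norm_coord_right_le (f : Calderon ellCouple) (s : Finset ℕ) (t : ℝ) :
    ∑ k ∈ s, ‖coord k (1 + t * Complex.I) f‖ ≤ ‖f‖ := by
  have h := lp.sum_rpow_le_norm_rpow (p := 1) (by norm_num) (f.right t) s
  simp only [ENNReal.toReal_one, Real.rpow_one] at h
  simp only [coord_right]
  exact h.trans (norm_right_le f t)

theorem norm_sum_mul_le {s : Finset ℕ} {ε a b : ℕ → ℂ} {A B : ℝ} (hε : ∀ k, ‖ε k‖ ≤ 1)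
    (ha : ∀ k, ‖a k‖ ≤ A) (hb : ∑ k ∈ s, ‖b k‖ ≤ B) (hA : 0 ≤ A) :
    ‖∑ k ∈ s, ε k * (a k * b k)‖ ≤ A * B := by
  refine (norm_sum_le _ _).trans (le_trans ?_ (mul_le_mul_of_nonneg_left hb hA))
  rw [Finset.mul_sum]
  refine Finset.sum_le_sum fun k _ => ?_
  rw [norm_mul, norm_mul]
  calc ‖ε k‖ * (‖a k‖ * ‖b k‖) ≤ 1 * (‖a k‖ * ‖b k‖) := by gcongr; exact hε k
    _ ≤ A * ‖b k‖ := by rw [one_mul]; gcongr; exact ha k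

theorem one_sub_mem_strip {w : ℂ} (hw : w ∈ strip) : 1 - w ∈ strip := (reflect ⟨w, hw⟩).2

theorem one_sub_mem_closedStrip {w : ℂ} (hw : w ∈ closedStrip) : 1 - w ∈ closedStrip := by
  have h : 0 ≤ w.re ∧ w.re ≤ 1 := hw
  change 0 ≤ (1 - w).re ∧ (1 - w).re ≤ 1
  simp only [Complex.sub_re, Complex.one_re]
  constructor <;> linarith [h.1, h.2]

theorem differentiableOn_coord_mul (f g : Calderon ellCouple) (k : ℕ) :
    DifferentiableOn ℂ (fun w => coord k w f * coord k (1 - w) g) strip :=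
  (differentiableOn_coord f k).mul
    ((differentiableOn_coord g k).comp (by fun_prop) fun _ hw => one_sub_mem_strip hw)

theorem continuousOn_coord_mul (f g : Calderon ellCouple) (k : ℕ) :
    ContinuousOn (fun w => coord k w f * coord k (1 - w) g) closedStrip :=
  (continuousOn_coord f k).mul
    ((continuousOn_coord g k).comp (by fun_prop) fun _ hw => one_sub_mem_closedStrip hw)

/-- The pairing `⟨f(w), g(1 - w)⟩` is bounded by `‖f‖ ‖g‖` on the strip. -/
theorem norm_sum_coord_mul_le (f g : Calderon ellCouple) (s : Finset ℕ) {ε : ℕ → ℂ}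
    (hε : ∀ k, ‖ε k‖ ≤ 1) {w : ℂ} (hw : w ∈ closedStrip) :
    ‖∑ k ∈ s, ε k * (coord k w f * coord k (1 - w) g)‖ ≤ ‖f‖ * ‖g‖ := by
  have hd : DifferentiableOn ℂ (fun w => ∑ k ∈ s, ε k * (coord k w f * coord k (1 - w) g)) strip :=
    DifferentiableOn.fun_sum fun k _ => (differentiableOn_coord_mul f g k).const_mul (ε k)
  have hc : ContinuousOn (fun w => ∑ k ∈ s, ε k * (coord k w f * coord k (1 - w) g)) closedStrip :=
    continuousOn_finsetSum _ fun k _ => (continuousOn_coord_mul f g k).const_smul (ε k)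
  have hdc : DiffContOnCl ℂ (fun w => ∑ k ∈ s, ε k * (coord k w f * coord k (1 - w) g))
      (Complex.re ⁻¹' Set.Ioo 0 1) := ⟨hd, hc.mono closure_strip_subset⟩
  refine PhragmenLindelof.vertical_strip hdc ?_ ?_ ?_ hw.1 hw.2
  · refine ⟨0, by simpa using Real.pi_pos, 0, ?_⟩
    have hM : ∀ (h : Calderon ellCouple) (k : ℕ) (w : ℂ), ‖coord k w h‖ ≤
        max ‖ellCouple.emb₀‖ ‖ellCouple.emb₁‖ * ‖h‖ := fun h k w =>
      (lp.norm_apply_le_norm ENNReal.top_ne_zero (h.toFun w) k).trans (norm_toFun_le_trace h w)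
    refine Asymptotics.IsBigO.of_bound (∑ k ∈ s,
      (max ‖ellCouple.emb₀‖ ‖ellCouple.emb₁‖ * ‖f‖) *
        (max ‖ellCouple.emb₀‖ ‖ellCouple.emb₁‖ * ‖g‖)) (Filter.Eventually.of_forall fun w => ?_)
    simp only [zero_mul, Real.exp_zero, norm_one, mul_one]
    refine norm_sum_le_of_le _ fun k _ => ?_
    rw [norm_mul, norm_mul]
    refine (mul_le_of_le_one_left (by positivity) (hε k)).trans ?_
    exact mul_le_mul (hM f k w) (hM g k (1 - w)) (norm_nonneg _) ((norm_nonneg _).trans (hM f k w))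
  · intro w hw
    obtain ⟨t, rfl⟩ : ∃ t : ℝ, w = t * Complex.I :=
      ⟨w.im, by apply Complex.ext <;> simp [hw]⟩
    -- Hölder on the left edge: f is read in ℓ_∞ and g, reflected to the right edge, in ℓ_1. On the
    -- other edge the roles are exchanged.
    have h : 1 - (t : ℂ) * Complex.I = 1 + ((-t : ℝ) : ℂ) * Complex.I := by push_cast; ring
    rw [h]
    exact norm_sum_mul_le hε (fun k => norm_coord_left_le f k t)
      (sum_norm_coord_right_le g s (-t)) (norm_nonneg f)
  · intro w hw
    obtain ⟨t, rfl⟩ : ∃ t : ℝ, w = 1 + t * Complex.I :=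
      ⟨w.im, by apply Complex.ext <;> simp [hw]⟩
    have h : 1 - (1 + (t : ℂ) * Complex.I) = ((-t : ℝ) : ℂ) * Complex.I := by push_cast; ring
    rw [h, mul_comm ‖f‖]
    simp only [mul_comm (coord _ (1 + (t : ℂ) * Complex.I) f)]
    exact norm_sum_mul_le hε (fun k => norm_coord_left_le g k (-t))
      (sum_norm_coord_right_le f s t) (norm_nonneg g)

end Calderon

/-! ### Cauchy integrals at z -/

/-- The radius of a disc around `z` contained in the strip. -/
def radius (z : strip) : ℝ := min z.1.re (1 - z.1.re) / 2

theorem radius_pos (z : strip) : 0 < radius z :=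
  half_pos (lt_min z.2.1 (sub_pos.2 z.2.2))

theorem closedBall_radius_subset (z : strip) : Metric.closedBall z.1 (radius z) ⊆ strip := by
  intro w hw
  rw [Metric.mem_closedBall, dist_eq_norm] at hw
  have h := abs_le.1 ((Complex.abs_re_le_norm (w - z.1)).trans hw)
  rw [Complex.sub_re] at h
  have h1 : radius z < z.1.re :=
    (half_lt_self (lt_min z.2.1 (sub_pos.2 z.2.2))).trans_le (min_le_left _ _)
  have h2 : radius z < 1 - z.1.re :=
    (half_lt_self (lt_min z.2.1 (sub_pos.2 z.2.2))).trans_le (min_le_right _ _)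
  exact ⟨by linarith [h.1], by linarith [h.2]⟩

theorem sphere_radius_subset (z : strip) : Metric.sphere z.1 (radius z) ⊆ strip :=
  Metric.sphere_subset_closedBall.trans (closedBall_radius_subset z)

theorem ratio_ne_zero {z : strip} {w : ℂ} (hw : w ∈ Metric.sphere z.1 (radius z)) :
    ratio z.1 (-1) w ≠ 0 := by
  refine div_ne_zero (sub_ne_zero.2 fun h => ?_)
    (isFar_neg_one.sub_ne_zero (strip_subset_closedStrip (sphere_radius_subset z hw)))
  rw [h, mem_sphere_iff_norm, sub_self, norm_zero] at hw
  exact (radius_pos z).ne hw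

/-- The coefficient of order `m` at `z` of an analytic function, with respect to the powers of
`(w - z) / (w + 1)`, as a Cauchy integral. -/
def cauchyCoeff (m : ℕ) (z : strip) (F : ℂ → ℂ) : ℂ :=
  (2 * Real.pi * Complex.I : ℂ)⁻¹ •
    ∮ w in C(z.1, radius z), (w - z.1)⁻¹ • ((ratio z.1 (-1) w ^ m)⁻¹ * F w)

theorem continuousOn_cauchyKernel (m : ℕ) (z : strip) :
    ContinuousOn (fun w => (w - z.1)⁻¹ * (ratio z.1 (-1) w ^ m)⁻¹)
      (Metric.sphere z.1 (radius z)) := by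
  refine ContinuousOn.mul (ContinuousOn.inv₀ (by fun_prop) fun w hw => ?_)
    (ContinuousOn.inv₀ (ContinuousOn.pow ?_ m) fun w hw => pow_ne_zero m (ratio_ne_zero hw))
  · exact left_ne_zero_of_mul (ratio_ne_zero hw)
  · exact (isFar_neg_one.isMultiplier_ratio z.1).continuousOn.mono
      ((sphere_radius_subset z).trans strip_subset_closedStrip)

theorem continuousOn_cauchyIntegrand (m : ℕ) (z : strip) {F : ℂ → ℂ}
    (hF : ContinuousOn F (Metric.sphere z.1 (radius z))) :
    ContinuousOn (fun w => (w - z.1)⁻¹ • ((ratio z.1 (-1) w ^ m)⁻¹ * F w))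
      (Metric.sphere z.1 (radius z)) :=
  ((continuousOn_cauchyKernel m z).mul hF).congr fun w _ => by
    simp only [smul_eq_mul, Pi.mul_apply, mul_assoc]

theorem cauchyCoeff_congr (m : ℕ) (z : strip) {F G : ℂ → ℂ}
    (h : ∀ w ∈ strip, F w = G w) : cauchyCoeff m z F = cauchyCoeff m z G := by
  unfold cauchyCoeff
  congr 1
  refine circleIntegral.integral_congr (radius_pos z).le fun w hw => ?_
  simp only [h w (sphere_radius_subset z hw)]

theorem cauchyCoeff_add (m : ℕ) (z : strip) {F G : ℂ → ℂ}
    (hF : ContinuousOn F (Metric.sphere z.1 (radius z)))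
    (hG : ContinuousOn G (Metric.sphere z.1 (radius z))) :
    cauchyCoeff m z (fun w => F w + G w) = cauchyCoeff m z F + cauchyCoeff m z G := by
  unfold cauchyCoeff
  rw [← smul_add, ← circleIntegral.integral_add
    ((continuousOn_cauchyIntegrand m z hF).circleIntegrable (radius_pos z).le)
    ((continuousOn_cauchyIntegrand m z hG).circleIntegrable (radius_pos z).le)]
  simp only [mul_add, smul_add]

theorem cauchyCoeff_const_mul (m : ℕ) (z : strip) (c : ℂ) (F : ℂ → ℂ) :
    cauchyCoeff m z (fun w => c * F w) = c * cauchyCoeff m z F := by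
  have h : ∀ w, (w - z.1)⁻¹ • ((ratio z.1 (-1) w ^ m)⁻¹ * (c * F w))
      = c • ((w - z.1)⁻¹ • ((ratio z.1 (-1) w ^ m)⁻¹ * F w)) := fun w => by
    simp only [smul_eq_mul]
    ring
  simp only [cauchyCoeff, h, circleIntegral.integral_smul]
  rw [smul_comm, smul_eq_mul]

theorem cauchyCoeff_sum (m : ℕ) (z : strip) (s : Finset ℕ) (ε : ℕ → ℂ) {F : ℕ → ℂ → ℂ}
    (hF : ∀ k, ContinuousOn (F k) (Metric.sphere z.1 (radius z))) :
    cauchyCoeff m z (fun w => ∑ k ∈ s, ε k * F k w) = ∑ k ∈ s, ε k * cauchyCoeff m z (F k) := by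
  classical
  induction s using Finset.induction_on with
  | empty => simp [cauchyCoeff, circleIntegral]
  | insert a s ha ih =>
    simp only [Finset.sum_insert ha]
    have h1 : ∀ k, ContinuousOn (fun w => ε k * F k w) (Metric.sphere z.1 (radius z)) :=
      fun k => continuousOn_const.mul (hF k)
    rw [cauchyCoeff_add m z (h1 a) (continuousOn_finsetSum _ fun k _ => h1 k),
      cauchyCoeff_const_mul, ih]

theorem exists_norm_cauchyCoeff_le (m : ℕ) (z : strip) :
    ∃ κ : ℝ, 0 ≤ κ ∧ ∀ (F : ℂ → ℂ) (C : ℝ), (∀ w ∈ strip, ‖F w‖ ≤ C) →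
      ‖cauchyCoeff m z F‖ ≤ κ * C := by
  obtain ⟨B, hB⟩ := (isCompact_sphere z.1 (radius z)).exists_bound_of_continuousOn
    (continuousOn_cauchyKernel m z)
  refine ⟨radius z * |B|, mul_nonneg (radius_pos z).le (abs_nonneg B), fun F C hC => ?_⟩
  rw [mul_assoc]
  refine circleIntegral.norm_two_pi_i_inv_smul_integral_le_of_norm_le_const (radius_pos z).le
    fun w hw => ?_
  rw [smul_eq_mul, ← mul_assoc, norm_mul]
  exact mul_le_mul ((hB w hw).trans (le_abs_self B)) (hC w (sphere_radius_subset z hw))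
    (norm_nonneg _) (abs_nonneg B)

/-- The extra ratio cancels one power in the kernel, which has no singularity on the circle. With
`cauchyCoeff_zero`, this shift rule is the only computation of these integrals the duality needs. -/
theorem cauchyCoeff_succ_ratio_mul (m : ℕ) (z : strip) (F : ℂ → ℂ) :
    cauchyCoeff (m + 1) z (fun w => ratio z.1 (-1) w * F w) = cauchyCoeff m z F := by
  unfold cauchyCoeff
  congr 1
  refine circleIntegral.integral_congr (radius_pos z).le fun w hw => ?_
  have := ratio_ne_zero hw
  simp only
  congr 1
  field_simp
  ring

theorem cauchyCoeff_zero (z : strip) {F : ℂ → ℂ} (hF : DifferentiableOn ℂ F strip) :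
    cauchyCoeff 0 z F = F z.1 := by
  have h : DiffContOnCl ℂ F (Metric.ball z.1 (radius z)) :=
    (hF.mono (Metric.closure_ball_subset_closedBall.trans
      (closedBall_radius_subset z))).diffContOnCl
  have := h.two_pi_i_inv_smul_circleIntegral_sub_inv_smul (Metric.mem_ball_self (radius_pos z))
  simpa only [cauchyCoeff, pow_zero, inv_one, one_mul] using this

/-! ### The bilinear pairing -/

namespace Calderon

/-- The contribution of the `k`-th coordinate to the pairing of `f` and `g`. -/
def pairTerm (m : ℕ) (z : strip) (g f : Calderon ellCouple) (k : ℕ) : ℂ :=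
  cauchyCoeff m z fun w => coord k w f * coord k (1 - w) g

/-- A phase aligning ζ with its modulus. Its vanishing at ζ = 0 lets spikes with a zero base be
discarded later. -/
theorem exists_norm_eq_mul (ζ : ℂ) :
    ∃ σ : ℂ, ‖σ‖ ≤ 1 ∧ σ * ζ = ‖ζ‖ ∧ (ζ = 0 → σ = 0) := by
  rcases eq_or_ne ζ 0 with rfl | h
  · exact ⟨0, by simp, by simp, fun _ => rfl⟩
  · exact ⟨‖ζ‖ / ζ, by simp [h], div_mul_cancel₀ _ h, fun h0 => absurd h0 h⟩

/-- Phases inserted before integration turn the sum of moduli into one Cauchy integral, bounded by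
the three lines estimate uniformly in the finite set. -/
theorem exists_sum_norm_pairTerm_le (m : ℕ) (z : strip) :
    ∃ κ : ℝ, 0 ≤ κ ∧ ∀ (g f : Calderon ellCouple) (s : Finset ℕ),
      ∑ k ∈ s, ‖pairTerm m z g f k‖ ≤ κ * ‖g‖ * ‖f‖ := by
  obtain ⟨κ, hκ, h⟩ := exists_norm_cauchyCoeff_le m z
  refine ⟨κ, hκ, fun g f s => ?_⟩
  choose ε hε hε' _ using fun k => exists_norm_eq_mul (pairTerm m z g f k)
  have h1 := h (fun w => ∑ k ∈ s, ε k * (coord k w f * coord k (1 - w) g)) (‖f‖ * ‖g‖)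
    fun w hw => norm_sum_coord_mul_le f g s hε (strip_subset_closedStrip hw)
  rw [cauchyCoeff_sum m z s ε fun k => (continuousOn_coord_mul f g k).mono
    ((sphere_radius_subset z).trans strip_subset_closedStrip)] at h1
  have h2 : ∑ k ∈ s, ε k * cauchyCoeff m z (fun w => coord k w f * coord k (1 - w) g)
      = ((∑ k ∈ s, ‖pairTerm m z g f k‖ : ℝ) : ℂ) := by
    push_cast
    exact Finset.sum_congr rfl fun k _ => hε' k
  rw [h2, Complex.norm_real, Real.norm_of_nonneg (Finset.sum_nonneg fun _ _ => norm_nonneg _)] at h1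
  linarith

theorem summable_norm_pairTerm (m : ℕ) (z : strip) (g f : Calderon ellCouple) :
    Summable fun k => ‖pairTerm m z g f k‖ := by
  obtain ⟨κ, -, h⟩ := exists_sum_norm_pairTerm_le m z
  exact summable_of_sum_le (fun _ => norm_nonneg _) (h g f)

theorem continuousOn_sphere_coord_mul (z : strip) (f g : Calderon ellCouple) (k : ℕ) :
    ContinuousOn (fun w => coord k w f * coord k (1 - w) g) (Metric.sphere z.1 (radius z)) :=
  (continuousOn_coord_mul f g k).mono ((sphere_radius_subset z).trans strip_subset_closedStrip)

/-- The bilinear pairing `Σ_k c_m(f_k(w) g_k(1 - w))` on `𝒞(ℓ_∞, ℓ_1)`, where `c_m` is the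
coefficient of order `m` at `z`. -/
def pairing (m : ℕ) (z : strip) :
    Calderon ellCouple →L[ℂ] Calderon ellCouple →L[ℂ] ℂ :=
  (LinearMap.mk₂ ℂ (fun g f => ∑' k, pairTerm m z g f k)
    (fun g g' f => by
      rw [← (summable_norm_pairTerm m z g f).of_norm.tsum_add
        (summable_norm_pairTerm m z g' f).of_norm]
      refine tsum_congr fun k => ?_
      simp only [pairTerm]
      rw [← cauchyCoeff_add m z (continuousOn_sphere_coord_mul z f g k)
        (continuousOn_sphere_coord_mul z f g' k)]
      simp only [map_add, mul_add])
    (fun c g f => by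
      rw [smul_eq_mul, ← tsum_mul_left]
      refine tsum_congr fun k => ?_
      simp only [pairTerm]
      rw [← cauchyCoeff_const_mul]
      simp only [map_smul, smul_eq_mul, mul_left_comm])
    (fun g f f' => by
      rw [← (summable_norm_pairTerm m z g f).of_norm.tsum_add
        (summable_norm_pairTerm m z g f').of_norm]
      refine tsum_congr fun k => ?_
      simp only [pairTerm]
      rw [← cauchyCoeff_add m z (continuousOn_sphere_coord_mul z f g k)
        (continuousOn_sphere_coord_mul z f' g k)]
      simp only [map_add, add_mul])
    (fun c g f => by
      rw [smul_eq_mul, ← tsum_mul_left]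
      refine tsum_congr fun k => ?_
      simp only [pairTerm]
      rw [← cauchyCoeff_const_mul]
      simp only [map_smul, smul_eq_mul, mul_assoc])).mkContinuous₂
    (exists_sum_norm_pairTerm_le m z).choose fun g f =>
      tsum_of_norm_bounded (summable_norm_pairTerm m z g f).hasSum (fun _ => le_rfl) |>.trans
        ((summable_norm_pairTerm m z g f).tsum_le_of_sum_le
          ((exists_sum_norm_pairTerm_le m z).choose_spec.2 g f))

theorem pairing_apply (m : ℕ) (z : strip) (g f : Calderon ellCouple) :
    pairing m z g f = ∑' k, pairTerm m z g f k := rfl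

/-- Multiplication by `(w - z) / (w + 1)`. -/
def mulLeft (z : strip) : Calderon ellCouple →L[ℂ] Calderon ellCouple :=
  mul ellCouple (isFar_neg_one.isMultiplier_ratio z.1)

/-- Multiplication by the reflected function `(w - (1 - z)) / (w - 2)`. -/
def mulRight (z : strip) : Calderon ellCouple →L[ℂ] Calderon ellCouple :=
  mul ellCouple (isFar_two.isMultiplier_ratio (reflect z).1)

theorem ratio_one_sub (z w : ℂ) : ratio (1 - z) 2 (1 - w) = ratio z (-1) w := by
  unfold ratio
  rw [← neg_div_neg_eq]
  congr 1 <;> ring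

/-- A ratio on either factor multiplies the product f_k(w) g_k(1 - w) by φ(w), so the shift rule
lowers the order by one; see also `pairing_succ_mulRight`. -/
theorem pairing_succ_mulLeft (m : ℕ) (z : strip) (g f : Calderon ellCouple) :
    pairing (m + 1) z g (mulLeft z f) = pairing m z g f := by
  rw [pairing_apply, pairing_apply]
  refine tsum_congr fun k => ?_
  refine (cauchyCoeff_congr (m + 1) z fun w hw => ?_).trans
    (cauchyCoeff_succ_ratio_mul m z fun w => coord k w f * coord k (1 - w) g)
  rw [mulLeft, coord_mul _ _ _ (strip_subset_closedStrip hw), mul_assoc]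

theorem pairing_succ_mulRight (m : ℕ) (z : strip) (g f : Calderon ellCouple) :
    pairing (m + 1) z (mulRight z g) f = pairing m z g f := by
  rw [pairing_apply, pairing_apply]
  refine tsum_congr fun k => ?_
  refine (cauchyCoeff_congr (m + 1) z fun w hw => ?_).trans
    (cauchyCoeff_succ_ratio_mul m z fun w => coord k w f * coord k (1 - w) g)
  rw [mulRight, coord_mul _ _ _ (strip_subset_closedStrip (one_sub_mem_strip hw)), mul_left_comm]
  congr 1
  exact ratio_one_sub z.1 w

theorem pairTerm_zero (z : strip) (g f : Calderon ellCouple) (k : ℕ) :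
    pairTerm 0 z g f k = coord k z.1 f * coord k (1 - z.1) g :=
  cauchyCoeff_zero z (differentiableOn_coord_mul f g k)

theorem pairing_zero (z : strip) (g f : Calderon ellCouple) :
    pairing 0 z g f = ∑' k, coord k z.1 f * coord k (1 - z.1) g :=
  tsum_congr fun k => pairTerm_zero z g f k

theorem toFun_mulLeft (z : strip) (f : Calderon ellCouple) : (mulLeft z f).toFun z.1 = 0 := by
  rw [mulLeft, mul_toFun _ _ (strip_subset_closedStrip z.2), ratio, sub_self, zero_div, zero_smul]

theorem pairing_mulLeft_pow (m : ℕ) (z : strip) (g f : Calderon ellCouple) :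
    pairing m z g ((mulLeft z ^ m) f) = pairing 0 z g f := by
  induction m with
  | zero => rfl
  | succ m ih =>
    rw [pow_succ', ← ih]
    exact pairing_succ_mulLeft m z g _

theorem pairing_mulLeft_pow_succ (m : ℕ) (z : strip) (g f : Calderon ellCouple) :
    pairing m z g ((mulLeft z ^ (m + 1)) f) = 0 := by
  rw [pow_succ]
  refine (pairing_mulLeft_pow m z g (mulLeft z f)).trans ?_
  rw [pairing_zero]
  have h := (toFun_eq_zero_iff _ _).1 (toFun_mulLeft z f)
  simp [h]

/-! ### Test functions supported on single coordinates -/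

/-- The constant function with value the `k`-th unit vector. -/
def unit (k : ℕ) : Calderon ellCouple :=
  ofFun (fun _ => lp.single ∞ k (1 : ℂ)) (differentiableOn_const _) continuousOn_const
    ⟨_, fun _ _ => le_rfl⟩
    ⟨BoundedContinuousFunction.const ℝ (lp.single ∞ k (1 : ℂ)), fun _ => rfl⟩
    ⟨BoundedContinuousFunction.const ℝ (lp.single 1 k (1 : ℂ)), fun _ => lp.ext rfl⟩

theorem coord_unit (j k : ℕ) {w : ℂ} (hw : w ∈ closedStrip) :
    coord j w (unit k) = if j = k then 1 else 0 := by
  rw [coord_apply, unit, ofFun_toFun hw, lp.single_apply]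
  simp [Pi.single_apply]

theorem unit_right (k : ℕ) (t : ℝ) : (unit k).right t = lp.single 1 k (1 : ℂ) :=
  right_apply_eq (by
    rw [unit, ofFun_toFun (right_mem_closedStrip t)]
    exact lp.ext rfl)

theorem norm_sum_mul_unit_le (s : Finset ℕ) {η : ℕ → ℂ → ℂ} (hη : ∀ k, IsMultiplier (η k)) {A : ℝ}
    (hA : 0 ≤ A) (h₀ : ∀ k ∈ s, ∀ t : ℝ, ‖η k (t * Complex.I)‖ ≤ A)
    (h₁ : ∀ t : ℝ, ∑ k ∈ s, ‖η k (1 + t * Complex.I)‖ ≤ A) :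
    ‖∑ k ∈ s, mul ellCouple (hη k) (unit k)‖ ≤ A := by
  refine norm_le (fun t => ?_) fun t => ?_
  · refine lp.norm_le_of_forall_le hA fun j => ?_
    rw [← coord_left, map_sum]
    simp only [coord_mul (hη _) _ _ (left_mem_closedStrip t),
      coord_unit _ _ (left_mem_closedStrip t), mul_ite, mul_one, mul_zero, Finset.sum_ite_eq]
    split_ifs with hj
    · exact h₀ j hj t
    · simpa using hA
  · have h : (∑ k ∈ s, mul ellCouple (hη k) (unit k)).right t
        = ∑ k ∈ s, (mul ellCouple (hη k) (unit k)).right t := by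
      have h1 : (∑ k ∈ s, mul ellCouple (hη k) (unit k)).right
          = ∑ k ∈ s, (mul ellCouple (hη k) (unit k)).right := by
        change (trace _).2 = _
        rw [map_sum, Prod.snd_sum]
        rfl
      rw [h1, BoundedContinuousFunction.sum_apply]
    rw [h]
    refine (norm_sum_le _ _).trans (le_trans (Finset.sum_le_sum fun k _ => ?_) (h₁ t))
    rw [mul_right, unit_right, norm_smul, lp.norm_single (by norm_num), norm_one, mul_one]

/-- The multiplier `w ↦ σ x ^ w`. -/
def power (σ : ℂ) (x : ℝ) (w : ℂ) : ℂ := σ * Complex.exp (w * Real.log x)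

theorem norm_power (σ : ℂ) (x : ℝ) (w : ℂ) :
    ‖power σ x w‖ = ‖σ‖ * Real.exp (w.re * Real.log x) := by
  rw [power, norm_mul, Complex.norm_exp]
  simp

theorem isMultiplier_power (σ : ℂ) (x : ℝ) : IsMultiplier (power σ x) where
  differentiableOn := by unfold power; fun_prop
  continuousOn := by unfold power; fun_prop
  bounded := by
    refine ⟨‖σ‖ * Real.exp |Real.log x|, fun w hw => ?_⟩
    have h : 0 ≤ w.re ∧ w.re ≤ 1 := hw
    rw [norm_power]
    gcongr
    calc w.re * Real.log x ≤ w.re * |Real.log x| := by gcongr; exacts [h.1, le_abs_self _]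
      _ ≤ 1 * |Real.log x| := by gcongr; exact h.2
      _ = _ := one_mul _

/-- The function with a single nonzero coordinate `σ x ^ w`. -/
def spike (σ : ℕ → ℂ) (x : ℕ → ℝ) (k : ℕ) : Calderon ellCouple :=
  mul ellCouple (isMultiplier_power (σ k) (x k)) (unit k)

theorem coord_spike (σ : ℕ → ℂ) (x : ℕ → ℝ) (j k : ℕ) {w : ℂ} (hw : w ∈ closedStrip) :
    coord j w (spike σ x k) = if j = k then power (σ k) (x k) w else 0 := by
  rw [spike, coord_mul _ _ _ hw, coord_unit _ _ hw, mul_ite, mul_one, mul_zero]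

/-- For x > 0, |x^{it}| = 1 and |x^{1+it}| = x, so the left edge sees the supremum of the |σ_k| and
the right edge the weighted sum. -/
theorem norm_sum_spike_le (s : Finset ℕ) (σ : ℕ → ℂ) {x : ℕ → ℝ} (hx : ∀ k ∈ s, σ k = 0 ∨ 0 < x k)
    {A : ℝ} (hA : 0 ≤ A) (h₀ : ∀ k ∈ s, ‖σ k‖ ≤ A) (h₁ : ∑ k ∈ s, ‖σ k‖ * x k ≤ A) :
    ‖∑ k ∈ s, spike σ x k‖ ≤ A := by
  refine norm_sum_mul_unit_le s (fun k => isMultiplier_power (σ k) (x k)) hA (fun k hk t => ?_)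
    fun t => le_trans (Finset.sum_le_sum fun k hk => ?_) h₁
  · rw [norm_power]
    simpa using h₀ k hk
  · rw [norm_power]
    -- The alternative σ = 0 is needed because `Real.log 0 = 0` makes the power equal to σ, not 0,
    -- when x = 0.
    rcases hx k hk with h | h
    · simp [h]
    · simp [Real.exp_log h]

end Calderon

/-- A summable nonnegative sequence is dominated, up to a null factor, by a positive summable
sequence. -/
theorem exists_pos_summable_tendsto_div {a : ℕ → ℝ} (ha : ∀ k, 0 ≤ a k) (hs : Summable a) :
    ∃ x : ℕ → ℝ, (∀ k, 0 < x k) ∧ Summable x ∧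
      Filter.Tendsto (fun k => a k / x k) Filter.atTop (nhds 0) := by
  -- The geometric term makes all tails r_k strictly positive. The weights √r_k - √r_{k+1}
  -- telescope, and b_k divided by them is √r_k + √r_{k+1}, which tends to 0.
  let b : ℕ → ℝ := fun k => a k + (1 / 2) ^ k
  have hb : ∀ k, 0 < b k := fun k => add_pos_of_nonneg_of_pos (ha k) (by positivity)
  have hbs : Summable b := hs.add summable_geometric_two
  let r : ℕ → ℝ := fun k => ∑' j, b (j + k)
  have hrs : ∀ k, Summable fun j => b (j + k) := fun k => (summable_nat_add_iff k).2 hbs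
  have hr : ∀ k, 0 < r k := fun k => (hrs k).tsum_pos (fun j => (hb _).le) 0 (hb _)
  have hstep : ∀ k, r k = b k + r (k + 1) := by
    intro k
    have := (hrs k).tsum_eq_zero_add
    simp only [zero_add] at this
    simp only [r]
    rw [this]
    congr 1
    exact tsum_congr fun j => by congr 1; ring
  have hr0 : Filter.Tendsto (fun k => √(r k)) Filter.atTop (nhds 0) := by
    have := (Real.continuous_sqrt.tendsto 0).comp (tendsto_sum_nat_add b)
    rwa [Real.sqrt_zero] at this
  have hpos : ∀ k, 0 < √(r k) - √(r (k + 1)) := fun k =>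
    sub_pos.2 (Real.sqrt_lt_sqrt (hr _).le (by rw [hstep k]; linarith [hb k]))
  refine ⟨fun k => √(r k) - √(r (k + 1)), hpos, ?_, ?_⟩
  · refine summable_of_sum_range_le (c := √(r 0)) (fun k => (hpos k).le) fun n => ?_
    rw [Finset.sum_range_sub']
    linarith [Real.sqrt_nonneg (r n)]
  · have h2 : Filter.Tendsto (fun k => √(r k) + √(r (k + 1))) Filter.atTop (nhds 0) := by
      simpa using hr0.add (hr0.comp (Filter.tendsto_add_atTop_nat 1))
    refine squeeze_zero (fun k => div_nonneg (ha k) (hpos k).le) (fun k => ?_) h2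
    rw [div_le_iff₀ (hpos k)]
    have h3 : (√(r k) + √(r (k + 1))) * (√(r k) - √(r (k + 1))) = b k := by
      have h4 := Real.mul_self_sqrt (hr k).le
      have h5 := Real.mul_self_sqrt (hr (k + 1)).le
      have h6 := hstep k
      nlinarith
    rw [h3]
    have : (0 : ℝ) ≤ (1 / 2) ^ k := by positivity
    simp only [b]
    linarith

/-! ### Representation of functionals -/

namespace Calderon

theorem apply_spike {z : strip} {Φ : StrongDual ℂ (Calderon ellCouple)}
    (hΦ : ∀ f, f.toFun z.1 = 0 → Φ f = 0) (σ : ℕ → ℂ) (x : ℕ → ℝ) (k : ℕ) :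
    Φ (spike σ x k) = power (σ k) (x k) z.1 * Φ (unit k) := by
  have hz := strip_subset_closedStrip z.2
  rw [← smul_eq_mul, ← map_smul, ← sub_eq_zero, ← map_sub]
  refine hΦ _ ((toFun_eq_zero_iff _ _).2 fun j => ?_)
  rw [map_sub, map_smul, coord_spike _ _ _ _ hz, coord_unit _ _ hz]
  simp

/-- A functional on `𝒞(ℓ_∞, ℓ_1)` which depends only on `f(z)` takes on the unit vectors values
which are summable to the power `1 / (1 - Re z)`. -/
theorem summable_rpow_apply_unit {z : strip} {Φ : StrongDual ℂ (Calderon ellCouple)}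
    (hΦ : ∀ f, f.toFun z.1 = 0 → Φ f = 0) :
    Summable fun k => ‖Φ (unit k)‖ ^ (1 / (1 - z.1.re)) := by
  have hθ1 : 0 < 1 - z.1.re := sub_pos.2 z.2.2
  set θ := z.1.re with hθ
  set a : ℕ → ℝ := fun k => ‖Φ (unit k)‖ ^ (1 / (1 - θ)) with ha_def
  have ha : ∀ k, 0 ≤ a k := fun k => by positivity
  refine summable_of_sum_le ha (c := ‖Φ‖ ^ (1 / (1 - θ))) fun s => ?_
  set A := ∑ k ∈ s, a k with hA_def
  rcases (Finset.sum_nonneg fun k _ => ha k : 0 ≤ A).eq_or_lt with hA | hA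
  · rw [hA_def, ← hA]
    positivity
  -- Extremal choice: the x_k sum to 1 over s, so the test function has norm at most 1, while Φ
  -- takes the value A^{1-θ} on it. Hence A^{1-θ} ≤ ‖Φ‖.
  let x : ℕ → ℝ := fun k => a k / A
  have hx : ∀ k, 0 ≤ x k := fun k => div_nonneg (ha k) hA.le
  choose σ hσ hσ' hσ0 using fun k =>
    exists_norm_eq_mul (Complex.exp (z.1 * Real.log (x k)) * Φ (unit k))
  have hnorm : ‖∑ k ∈ s, spike σ x k‖ ≤ 1 := by
    refine norm_sum_spike_le s σ (fun k _ => ?_) zero_le_one (fun k _ => hσ k) ?_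
    · by_cases hb : Φ (unit k) = 0
      · exact Or.inl (hσ0 k (by rw [hb, mul_zero]))
      · have : 0 < a k := Real.rpow_pos_of_pos (norm_pos_iff.2 hb) _
        exact Or.inr (div_pos this hA)
    · calc ∑ k ∈ s, ‖σ k‖ * x k ≤ ∑ k ∈ s, x k :=
            Finset.sum_le_sum fun k _ => mul_le_of_le_one_left (hx k) (hσ k)
        _ = 1 := by rw [← Finset.sum_div, div_self hA.ne']
  have hterm : ∀ k, Φ (spike σ x k) = ((A ^ (-θ) * a k : ℝ) : ℂ) := by
    intro k
    rw [apply_spike hΦ, power, mul_assoc, hσ', norm_mul, Complex.norm_exp]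
    congr 1
    rw [Complex.re_mul_ofReal, ← hθ]
    by_cases hb : Φ (unit k) = 0
    · have : a k = 0 := by
        simp only [a, hb, norm_zero]
        exact Real.zero_rpow (by positivity)
      rw [hb, this, norm_zero, mul_zero, mul_zero]
    · have hak : 0 < a k := Real.rpow_pos_of_pos (norm_pos_iff.2 hb) _
      have hb' : ‖Φ (unit k)‖ = a k ^ (1 - θ) := by
        rw [ha_def]
        simp only
        rw [← Real.rpow_mul (norm_nonneg _), one_div_mul_cancel hθ1.ne', Real.rpow_one]
      rw [hb', mul_comm θ, ← Real.rpow_def_of_pos (div_pos hak hA),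
        Real.div_rpow hak.le hA.le, Real.rpow_neg hA.le, div_mul_eq_mul_div,
        ← Real.rpow_add hak, add_sub_cancel, Real.rpow_one, div_eq_inv_mul]
  have hval : Φ (∑ k ∈ s, spike σ x k) = ((A ^ (1 - θ) : ℝ) : ℂ) := by
    rw [map_sum, Finset.sum_congr rfl fun k _ => hterm k, ← Complex.ofReal_sum, ← Finset.mul_sum,
      ← hA_def, sub_eq_neg_add, Real.rpow_add hA, Real.rpow_one]
  have hle : A ^ (1 - θ) ≤ ‖Φ‖ := by
    have h := (Φ.le_opNorm _).trans (mul_le_of_le_one_right (norm_nonneg Φ) hnorm)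
    rwa [hval, Complex.norm_real, Real.norm_of_nonneg (by positivity)] at h
  have := Real.rpow_le_rpow (by positivity) hle (one_div_pos.2 hθ1).le
  rwa [← Real.rpow_mul hA.le, mul_one_div_cancel hθ1.ne', Real.rpow_one] at this

/-- Sequences summable to the power `1 / Re z` are values at `z` of norm-convergent series of
functions with a single nonzero coordinate. -/
theorem exists_hasSum_spike (z : strip) {c : ℕ → ℂ}
    (hc : Summable fun k => ‖c k‖ ^ (1 / z.1.re)) :
    ∃ (σ : ℕ → ℂ) (x : ℕ → ℝ) (f : Calderon ellCouple), HasSum (spike σ x) f ∧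
      ∀ k, power (σ k) (x k) z.1 = c k := by
  have hθ0 : 0 < z.1.re := z.2.1
  obtain ⟨x, hx, hxs, hlim⟩ := exists_pos_summable_tendsto_div (fun k => by positivity) hc
  -- Forced by σ_k x_k^z = c_k. Then |σ_k| = (|c_k|^{1/θ}/x_k)^θ tends to 0, which the left-edge sup
  -- norm requires for norm convergence of the series.
  let σ : ℕ → ℂ := fun k => c k * Complex.exp (-(z.1 * Real.log (x k)))
  have hσ : ∀ k, ‖σ k‖ = (‖c k‖ ^ (1 / z.1.re) / x k) ^ z.1.re := by
    intro k
    rw [Real.div_rpow (by positivity) (hx k).le, ← Real.rpow_mul (norm_nonneg _),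
      one_div_mul_cancel hθ0.ne', Real.rpow_one, Real.rpow_def_of_pos (hx k), norm_mul,
      Complex.norm_exp, Complex.neg_re, Complex.re_mul_ofReal, Real.exp_neg, div_eq_mul_inv,
      mul_comm (Real.log _)]
  have hσ0 : Filter.Tendsto (fun k => ‖σ k‖) Filter.atTop (nhds 0) := by
    have := hlim.rpow_const (Or.inr hθ0.le : _ ∨ 0 ≤ z.1.re)
    rw [Real.zero_rpow hθ0.ne'] at this
    exact this.congr fun k => (hσ k).symm
  obtain ⟨D, hD⟩ := hσ0.bddAbove_range
  have hsum : Summable fun k => ‖σ k‖ * x k :=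
    Summable.of_nonneg_of_le (fun k => mul_nonneg (norm_nonneg _) (hx k).le)
      (fun k => mul_le_mul_of_nonneg_right (hD ⟨k, rfl⟩) (hx k).le) (hxs.mul_left D)
  have hsp : Summable (spike σ x) := by
    rw [summable_iff_vanishing_norm]
    intro ε hε
    obtain ⟨N, hN⟩ := Filter.eventually_atTop.1 (hσ0.eventually_le_const (half_pos hε))
    obtain ⟨s, hs⟩ := summable_iff_vanishing_norm.1 hsum (ε / 2) (half_pos hε)
    refine ⟨s ∪ Finset.range N, fun t ht => ?_⟩
    rw [Finset.disjoint_union_right] at ht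
    refine (norm_sum_spike_le t σ (fun k _ => Or.inr (hx k)) (half_pos hε).le (fun k hk => ?_)
      ?_).trans_lt (half_lt_self hε)
    · refine hN k (not_lt.1 fun h => ?_)
      exact Finset.disjoint_left.1 ht.2 hk (Finset.mem_range.2 h)
    · exact (le_abs_self _).trans (hs t ht.1).le
  obtain ⟨f, hf⟩ := hsp
  refine ⟨σ, x, f, hf, fun k => ?_⟩
  rw [power, mul_assoc, ← Complex.exp_add, neg_add_cancel, Complex.exp_zero, mul_one]

theorem coord_of_hasSum_spike {σ : ℕ → ℂ} {x : ℕ → ℝ} {f : Calderon ellCouple}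
    (hf : HasSum (spike σ x) f) {w : ℂ} (hw : w ∈ closedStrip) (k : ℕ) :
    coord k w f = power (σ k) (x k) w := by
  have h := (coord k w).hasSum hf
  simp only [coord_spike _ _ _ _ hw] at h
  refine h.unique ((hasSum_ite_eq k (power (σ k) (x k) w)).congr_fun fun j => ?_)
  by_cases hj : j = k
  · rw [hj]
  · rw [if_neg hj, if_neg (Ne.symm hj)]

theorem pairing_zero_unit (z : strip) (g : Calderon ellCouple) (k : ℕ) :
    pairing 0 z g (unit k) = coord k (1 - z.1) g := by
  rw [pairing_zero, tsum_eq_single k fun j hj => ?_]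
  · rw [coord_unit _ _ (strip_subset_closedStrip z.2), if_pos rfl, one_mul]
  · rw [coord_unit _ _ (strip_subset_closedStrip z.2), if_neg hj, zero_mul]

/-- The values at `z` of functions in `𝒞(ℓ_∞, ℓ_1)` are summable to the power `1 / Re z`. -/
theorem summable_rpow_coord (z : strip) (f : Calderon ellCouple) :
    Summable fun k => ‖coord k z.1 f‖ ^ (1 / z.1.re) := by
  -- The pairing of order 0 at 1 - z with f depends only on values at 1 - z, and its values on unit
  -- vectors are the coordinates of f(z).
  have h := summable_rpow_apply_unit (z := reflect z) (Φ := pairing 0 (reflect z) f) fun h hh => by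
    rw [pairing_zero]
    have := (toFun_eq_zero_iff _ _).1 hh
    simp [this]
  simpa [pairing_zero_unit, reflect] using h

/-- The values of Φ on unit vectors are realised as g(1 - z). Since unit vectors alone do not
determine Φ on all of 𝒞, f is traded for a convergent spike series with the same value at z. -/
theorem exists_pairing_zero_eq {z : strip} {Φ : StrongDual ℂ (Calderon ellCouple)}
    (hΦ : ∀ f, f.toFun z.1 = 0 → Φ f = 0) : ∃ g, pairing 0 z g = Φ := by
  have hz := strip_subset_closedStrip z.2
  have hb : Summable fun k => ‖Φ (unit k)‖ ^ (1 / (reflect z).1.re) := by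
    simpa [reflect] using summable_rpow_apply_unit hΦ
  obtain ⟨τ, y, g, hg, hgz⟩ := exists_hasSum_spike (reflect z) hb
  refine ⟨g, ?_⟩
  ext f
  obtain ⟨σ, x, u, hu, huz⟩ := exists_hasSum_spike z (summable_rpow_coord z f)
  have hfu : Φ f = Φ u := by
    rw [← sub_eq_zero, ← map_sub]
    refine hΦ _ ((toFun_eq_zero_iff _ _).2 fun k => ?_)
    rw [map_sub, coord_of_hasSum_spike hu hz, huz, sub_self]
  rw [hfu, pairing_zero, ← (Φ.hasSum hu).tsum_eq]
  refine tsum_congr fun k => ?_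
  rw [apply_spike hΦ, huz, ← hgz]
  congr 1
  exact coord_of_hasSum_spike hg (strip_subset_closedStrip (reflect z).2) k

/-- In the inductive step `g₀` represents Φ after m + 1 multiplications by φ. The pairing of order m
+ 1 with `g₀` agrees with Φ on those multiples, so the difference is covered by order m; multiplying
its representative `g₁` by ψ restores order m + 1. -/
theorem exists_pairing_eq (m : ℕ) {z : strip} {Φ : StrongDual ℂ (Calderon ellCouple)}
    (hΦ : ∀ f, Φ ((mulLeft z ^ (m + 1)) f) = 0) : ∃ g, pairing m z g = Φ := by
  induction m generalizing Φ with
  | zero =>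
    refine exists_pairing_zero_eq fun f hf => ?_
    obtain ⟨u, rfl⟩ := exists_eq_mul_ratio isFar_neg_one z f hf
    have := hΦ u
    rw [zero_add, pow_one] at this
    exact this
  | succ m ih =>
    obtain ⟨g₀, hg₀⟩ := exists_pairing_zero_eq (z := z) (Φ := Φ.comp (mulLeft z ^ (m + 1)))
      fun f hf => by
        obtain ⟨u, rfl⟩ := exists_eq_mul_ratio isFar_neg_one z f hf
        have := hΦ u
        rw [pow_succ] at this
        exact this
    obtain ⟨g₁, hg₁⟩ := ih (Φ := Φ - pairing (m + 1) z g₀) fun f => by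
      have := DFunLike.congr_fun hg₀ f
      rw [sub_apply, pairing_mulLeft_pow, this, ContinuousLinearMap.comp_apply, sub_self]
    refine ⟨g₀ + mulRight z g₁, ?_⟩
    ext f
    have := DFunLike.congr_fun hg₁ f
    rw [map_add, add_apply, pairing_succ_mulRight, this]
    simp

/-! ### The kernel of the pairing in its first variable -/

theorem toFun_mulRight (z : strip) (g : Calderon ellCouple) :
    (mulRight z g).toFun (reflect z).1 = 0 := by
  rw [mulRight, mul_toFun _ _ (strip_subset_closedStrip (reflect z).2), ratio, sub_self, zero_div,
    zero_smul]

theorem pairing_mulRight_pow_succ (m : ℕ) (z : strip) (g f : Calderon ellCouple) :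
    pairing m z ((mulRight z ^ (m + 1)) g) f = 0 := by
  induction m with
  | zero =>
    rw [pairing_zero]
    have h : ∀ k, coord k (1 - z.1) (mulRight z g) = 0 :=
      (toFun_eq_zero_iff _ _).1 (toFun_mulRight z g)
    simp [h]
  | succ m ih =>
    rw [← ih, pow_succ' _ (m + 1)]
    exact pairing_succ_mulRight m z _ f

/-- Testing on φᵐ times the k-th unit vector isolates g_k(1 - z), so an annihilating g is divisible
by ψ; the quotient annihilates in order m - 1, and induction collects m + 1 factors. -/
theorem pairing_eq_zero_iff (m : ℕ) (z : strip) (g : Calderon ellCouple) :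
    (∀ f, pairing m z g f = 0) ↔ jet ellCouple (m + 1) (reflect z) g = 0 := by
  constructor
  · intro h
    have h0 : g.toFun (reflect z).1 = 0 := by
      refine (toFun_eq_zero_iff _ _).2 fun k => ?_
      have := h ((mulLeft z ^ m) (unit k))
      rwa [pairing_mulLeft_pow, pairing_zero_unit] at this
    induction m generalizing g with
    | zero => exact (jet_one_eq_zero_iff _ _).2 h0
    | succ m ih =>
      obtain ⟨u, rfl⟩ := exists_eq_mul_ratio isFar_two (reflect z) g h0
      have hu : ∀ f, pairing m z u f = 0 := fun f => by
        rw [← pairing_succ_mulRight]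
        exact h f
      have hu0 : u.toFun (reflect z).1 = 0 := by
        refine (toFun_eq_zero_iff _ _).2 fun k => ?_
        have := hu ((mulLeft z ^ m) (unit k))
        rwa [pairing_mulLeft_pow, pairing_zero_unit] at this
      obtain ⟨v, rfl⟩ := (jet_eq_zero_iff isFar_two _ _ _).1 (ih u hu hu0)
      exact (jet_eq_zero_iff isFar_two _ _ _).2 ⟨v, by rw [pow_succ' _ (m + 1)]; rfl⟩
  · intro h f
    obtain ⟨v, rfl⟩ := (jet_eq_zero_iff isFar_two _ _ _).1 h
    exact pairing_mulRight_pow_succ m z v f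

end Calderon

/-! ### The duality theorem -/

theorem reflect_half : reflect half = half := by
  refine Subtype.ext ?_
  change (1 : ℂ) - 1 / 2 = 1 / 2
  norm_num

/-- The dual of the Rochberg space of `(ℓ_∞, ℓ_1)` at `z` is the Rochberg space at `1 - z`. -/
theorem nonempty_dual_equiv_reflect (z : strip) {n : ℕ} (hn : 1 ≤ n) :
    Nonempty (StrongDual ℂ (RochbergSpace ellCouple n z) ≃L[ℂ]
      RochbergSpace ellCouple n (reflect z)) := by
  -- Jets of length m + 1 are matched by the pairing of order m.
  obtain ⟨m, rfl⟩ := Nat.exists_eq_add_of_le' hn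
  have hker : ∀ f, RochbergSpace.ofCalderon ellCouple (m + 1) z f = 0 ↔
      ∃ u, f = (Calderon.mulLeft z ^ (m + 1)) u := fun f =>
    (RochbergSpace.ofCalderon_eq_zero_iff f).trans
      (Calderon.jet_eq_zero_iff isFar_neg_one z (m + 1) f)
  refine nonempty_dual_equiv_of_pairing (RochbergSpace.ofCalderon ellCouple (m + 1) z)
    RochbergSpace.ofCalderon_surjective (RochbergSpace.ofCalderon ellCouple (m + 1) (reflect z))
    RochbergSpace.ofCalderon_surjective (Calderon.pairing m z) (fun g f hf => ?_) (fun g => ?_)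
    fun Φ hΦ => ?_
  · obtain ⟨u, rfl⟩ := (hker f).1 hf
    exact Calderon.pairing_mulLeft_pow_succ m z g u
  · rw [RochbergSpace.ofCalderon_eq_zero_iff]
    exact Calderon.pairing_eq_zero_iff m z g
  · exact Calderon.exists_pairing_eq m fun f => hΦ _ ((hker _).2 ⟨f, rfl⟩)

end Rochberg

end

theorem mainTheorem12 :
    (∀ (z : Rochberg.strip) (n : ℕ), 1 ≤ n →
      Nonempty (StrongDual ℂ (Rochberg.RochbergSpace Rochberg.ellCouple n z) ≃L[ℂ]
        Rochberg.RochbergSpace Rochberg.ellCouple n (Rochberg.reflect z))) ∧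
    (∀ n : ℕ, 1 ≤ n →
      Nonempty (Rochberg.ZSpace n ≃L[ℂ] StrongDual ℂ (Rochberg.ZSpace n))) := by
  refine ⟨fun z n hn => Rochberg.nonempty_dual_equiv_reflect z hn, fun n hn => ?_⟩
  have h := Rochberg.nonempty_dual_equiv_reflect Rochberg.half hn
  rw [Rochberg.reflect_half] at h
  exact h.map ContinuousLinearEquiv.symm
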